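/- Let $\mathbb B$ be the set of nearest-neighbour (unoriented) edges of $\mathbb Z^d$, let $\Omega=(0,\infty)^{\mathbb B}$, and let $\mathbb P$ be a probability measure on $\Omega$ under which the conductances $(\omega_e)_{e\in\mathbb B}$ are independent and identically distributed and such that, for some $M>0$, almost surely $\omega_e\in[1,M]$ for all $e\in\mathbb B$. Write $\omega_{x,y}$ for the conductance of the edge between neighbours $x,y$, and let $(\theta_x\omega)_{y,z}=\omega_{x+y,x+z}$. For an environment $\omega$, let $\mathbf P^\omega_0$ be the law, on the space of càdlàg paths in $\mathbb Z^d$, of the continuous-time Markov process $(X_t)_{t\ge 0}$ started at $0$ with jump rate $\omega_{x,y}$ between neighbours $x,y$, let $\overline{\mathbb P}=\mathbb P\,\mathbf P^\omega_0$ be the annealed measure (the joint law of $(\omega,X)$), and let $\omega(t)=\theta_{X_t}\,\omega$. Fix $\xi\in\mathbb R^d$ and $\mu>0$, and let $\phi_\mu\in L^2(\mathbb P)$ (represented by a measurable function on $\Omega$) be the solution of $(\mu-\mathcal L)\phi_\mu=\mathfrak d$, where $$\mathcal L f(\omega)=\sum_{|z|=1}\omega_{0,z}\,\bigl(f(\theta_z\omega)-f(\omega)\bigr),\qquad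 \mathfrak d(\omega)=\sum_{|z|=1}\omega_{0,z}\;\xi\cdot z .$$ Define $$M_\mu(t)=\xi\cdot X_t+\phi_\mu(\omega(t))-\phi_\mu(\omega(0))-\mu\int_0^t\phi_\mu(\omega(s))\,\mathrm ds .$$ **Proposition.** The process $(M_\mu(t))_{t\ge0}$ is a (càdlàg, square-integrable) martingale under $\overline{\mathbb P}$ with respect to the filtration $\mathcal F_t=\sigma(\omega,\,X_s: s\le t)$, and its predictable quadratic variation is $$\langle M_\mu\rangle_t=\int_0^t v_\mu(\omega(s))\,\mathrm ds,\qquad v_\mu(\omega)=\sum_{|z|=1}\omega_{0,z}\,\bigl(\xi\cdot z+\phi_\mu(\theta_z\omega)-\phi_\mu(\omega)\bigr)^2 ;$$ that is, the process $A_t=\int_0^t v_\mu(\omega(s))\,\mathrm ds$ is predictable, nondecreasing, càdlàg, $A_0=0$, and $M_\mu^2-A$ is a martingale under $\overline{\mathbb P}$ with respect to $(\mathcal F_t)$. -/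

import Mathlib

open MeasureTheory ProbabilityTheory Set Filter
open scoped NNReal ENNReal Topology

namespace RandomConductance

/-! ### The lattice and its bonds -/

/-- The vertices of the lattice `ℤ^d`. -/
abbrev Zd (d : ℕ) : Type := Fin d → ℤ

/-- The nearest-neighbour graph on `ℤ^d`: `x ∼ y` iff `‖x - y‖₁ = 1`. -/
def latticeGraph (d : ℕ) : SimpleGraph (Zd d) where
  Adj x y := ∑ i, |x i - y i| = 1
  symm := ⟨fun x y h => by simpa only [abs_sub_comm] using h⟩
  loopless := ⟨fun x h => by simp at h⟩

/-- The set of unoriented nearest-neighbour edges of `ℤ^d`. -/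
abbrev Bond (d : ℕ) : Type := (latticeGraph d).edgeSet

/-- The finite set of all `z ∈ ℤ^d` with `|z| = 1` (see `mem_unitVectors`). -/
noncomputable def unitVectors (d : ℕ) : Finset (Zd d) :=
  (Fintype.piFinset fun _ => Finset.Icc (-1 : ℤ) 1).filter fun z => ∑ i, |z i| = 1

theorem mem_unitVectors {d : ℕ} (z : Zd d) :
    z ∈ unitVectors d ↔ ∑ i, |z i| = 1 := by
  simp only [unitVectors, Finset.mem_filter, Fintype.mem_piFinset, Finset.mem_Icc,
    and_iff_right_iff_imp]
  intro h i
  have h1 : |z i| ≤ ∑ j, |z j| :=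
    Finset.single_le_sum (f := fun j => |z j|) (fun j _ => abs_nonneg _) (Finset.mem_univ i)
  rw [h] at h1
  exact abs_le.mp h1

/-! ### Environments -/

/-- The space of environments `(0, ∞)^𝔹`, with its product σ-algebra. -/
abbrev Env (d : ℕ) : Type := Bond d → Set.Ioi (0 : ℝ)

open Classical in
/-- `conductance ω x y` is the conductance `ω_{x,y}` of the edge between the neighbours `x` and `y`
(and `0` when `x` and `y` are not neighbours). -/
noncomputable def conductance {d : ℕ} (ω : Env d) (x y : Zd d) : ℝ :=
  if h : (latticeGraph d).Adj x y then (ω ⟨s(x, y), h⟩ : ℝ) else 0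

theorem adj_shift {d : ℕ} (x y z : Zd d) :
    (latticeGraph d).Adj (x + y) (x + z) ↔ (latticeGraph d).Adj y z := by
  simp [latticeGraph]

/-- The translation by `x`, acting on the bonds. -/
def shiftBond {d : ℕ} (x : Zd d) (e : Bond d) : Bond d :=
  ⟨Sym2.map (fun y => x + y) e.1, by
    obtain ⟨e, he⟩ := e
    induction e using Sym2.ind with
    | _ y z => exact (adj_shift x y z).2 he⟩

/-- The translation `θ_x` of environments: `(θ_x ω)_{y,z} = ω_{x+y,x+z}`. -/
def shift {d : ℕ} (x : Zd d) (ω : Env d) : Env d := fun e => ω (shiftBond x e)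

theorem conductance_shift {d : ℕ} (x y z : Zd d) (ω : Env d) :
    conductance (shift x ω) y z = conductance ω (x + y) (x + z) := by
  by_cases h : (latticeGraph d).Adj y z
  · have h' := (adj_shift x y z).2 h
    simp only [conductance, h, h', dif_pos]
    rfl
  · have h' : ¬ (latticeGraph d).Adj (x + y) (x + z) := fun h' => h ((adj_shift x y z).1 h')
    simp only [conductance, h, h', dif_neg, not_false_eq_true]

/-- The standing assumptions on the law `P` of the environment: the conductances are independent
and identically distributed, and there is `M > 0` such that almost surely all of them lie in
`[1, M]`. -/
structure IsEnvLaw {d : ℕ} (P : Measure (Env d)) : Prop where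
  isProbabilityMeasure : IsProbabilityMeasure P
  indep : iIndepFun (fun (e : Bond d) (ω : Env d) => ω e) P
  identDistrib : ∀ e e' : Bond d,
    IdentDistrib (fun ω : Env d => ω e) (fun ω : Env d => ω e') P P
  elliptic : ∃ M : ℝ, 0 < M ∧ ∀ᵐ ω ∂P, ∀ e : Bond d, (ω e : ℝ) ∈ Set.Icc 1 M

/-! ### The random walk in a fixed environment -/

/-- The generator of the walk, `L^ω f (x) = ∑_{y ∼ x} ω_{x,y} (f y - f x)`. -/
noncomputable def walkGenerator {d : ℕ} (ω : Env d) (f : Zd d → ℝ) (x : Zd d) : ℝ :=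
  ∑ z ∈ unitVectors d, conductance ω x (x + z) * (f (x + z) - f x)

/-- `p t x y` (for `t ≥ 0`) is the (conservative) transition function on `ℤ^d` with jump rates
`ω_{x,y}`: stochastic matrices with `p 0 = 1`, the Chapman-Kolmogorov relation
`p (s + t) = p s p t`, and the Kolmogorov backward equation `(d/dt) p t = L^ω (p t)`. -/
structure IsTransitionFunction {d : ℕ} (ω : Env d) (p : ℝ → Zd d → Zd d → ℝ) :
    Prop where
  nonneg : ∀ t, 0 ≤ t → ∀ x y, 0 ≤ p t x y
  hasSum_one : ∀ t, 0 ≤ t → ∀ x, HasSum (fun y => p t x y) 1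
  zero : ∀ x y, p 0 x y = if x = y then 1 else 0
  chapman_kolmogorov : ∀ s t, 0 ≤ s → 0 ≤ t → ∀ x y,
    HasSum (fun z => p s x z * p t z y) (p (s + t) x y)
  backward : ∀ t, 0 ≤ t → ∀ x y,
    HasDerivWithinAt (fun s => p s x y) (walkGenerator ω (fun z => p t z y) x) (Set.Ici 0) t

/-- Right-continuous paths with left limits. -/
def IsCadlag {E : Type*} [TopologicalSpace E] (γ : ℝ≥0 → E) : Prop :=
  ∀ t, ContinuousWithinAt γ (Set.Ici t) t ∧ ∃ l, Tendsto γ (𝓝[<] t) (𝓝 l)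

/-- The space of càdlàg paths in `ℤ^d`, with the σ-algebra generated by the evaluations. -/
abbrev PathSpace (d : ℕ) : Type := {γ : ℝ≥0 → Zd d // IsCadlag γ}

/-- The canonical process `X_t` on the path space. -/
def walk {d : ℕ} (t : ℝ≥0) (γ : PathSpace d) : Zd d := γ.1 t

theorem measurable_walk {d : ℕ} (t : ℝ≥0) : Measurable (walk (d := d) t) :=
  (measurable_pi_apply t).comp measurable_subtype_coe

/-- The natural filtration `σ(X_s, s ≤ t)` of the canonical process. -/
noncomputable def walkFiltration (d : ℕ) :
    Filtration ℝ≥0 (inferInstance : MeasurableSpace (PathSpace d)) :=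
  Filtration.natural (fun t => walk (d := d) t) fun t => (measurable_walk t).stronglyMeasurable

/-- `Q` is the law `𝐏^ω_x` on the path space of the Markov process with jump rates `ω_{x,y}`
started at `x`: the canonical process starts at `x` and is Markov, with the transition function
with jump rates `ω_{x,y}`. -/
structure IsWalkLaw {d : ℕ} (ω : Env d) (x : Zd d) (Q : Measure (PathSpace d)) : Prop where
  isProbabilityMeasure : IsProbabilityMeasure Q
  start : ∀ᵐ γ ∂Q, walk 0 γ = x
  markov : ∃ p : ℝ → Zd d → Zd d → ℝ, IsTransitionFunction ω p ∧
    ∀ (s t : ℝ≥0) (y : Zd d),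
      Q[Set.indicator {γ | walk (s + t) γ = y} (fun _ => (1 : ℝ)) | walkFiltration d s]
        =ᵐ[Q] fun γ => p t (walk s γ) y

/-! ### The environment viewed by the particle and the approximate corrector -/

/-- The generator of the environment viewed by the particle,
`𝓛 f (ω) = ∑_{|z| = 1} ω_{0,z} (f (θ_z ω) - f ω)`. -/
noncomputable def envGenerator {d : ℕ} (f : Env d → ℝ) (ω : Env d) : ℝ :=
  ∑ z ∈ unitVectors d, conductance ω 0 z * (f (shift z ω) - f ω)

/-- The scalar product `ξ · x`. -/
noncomputable def dot {d : ℕ} (ξ : Fin d → ℝ) (x : Zd d) : ℝ := ∑ i, ξ i * (x i : ℝ)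

/-- The local drift in the direction `ξ`: `𝔡(ω) = L^ω (x ↦ ξ · x) (0)`. -/
noncomputable def localDrift {d : ℕ} (ξ : Fin d → ℝ) (ω : Env d) : ℝ :=
  walkGenerator ω (dot ξ) 0

/-- `φ` is (a measurable version of) the approximate corrector `φ_μ`, that is, of the element of
`L²(P)` with `(μ - 𝓛) φ_μ = 𝔡`. -/
structure IsApproxCorrector {d : ℕ} (P : Measure (Env d)) (ξ : Fin d → ℝ) (mu : ℝ)
    (φ : Env d → ℝ) : Prop where
  measurable : Measurable φ
  memLp : MemLp φ 2 P
  resolvent_eq : ∀ᵐ ω ∂P, mu * φ ω - envGenerator φ ω = localDrift ξ ω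

/-- The environment viewed by the particle, `ω(t) = θ_{X_t} ω`. -/
def envProcess {d : ℕ} (t : ℝ≥0) (η : Env d × PathSpace d) : Env d :=
  shift (walk t η.2) η.1

/-- The process
`M_μ(t) = ξ · X_t + φ_μ(ω(t)) - φ_μ(ω(0)) - μ ∫_0^t φ_μ(ω(s)) ds`. -/
noncomputable def martingalePart {d : ℕ} (ξ : Fin d → ℝ) (mu : ℝ) (φ : Env d → ℝ)
    (t : ℝ≥0) (η : Env d × PathSpace d) : ℝ :=
  dot ξ (walk t η.2) + φ (envProcess t η) - φ (envProcess 0 η)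
    - mu * ∫ s in (0 : ℝ)..t, φ (envProcess s.toNNReal η)

/-- `v_μ(ω) = ∑_{|z| = 1} ω_{0,z} (ξ · z + φ_μ(θ_z ω) - φ_μ(ω))²`. -/
noncomputable def energyDensity {d : ℕ} (ξ : Fin d → ℝ) (φ : Env d → ℝ) (ω : Env d) : ℝ :=
  ∑ z ∈ unitVectors d, conductance ω 0 z * (dot ξ z + φ (shift z ω) - φ ω) ^ 2

/-- The filtration `σ(ω, X_s, s ≤ t)` on the product of the space of environments and the path
space. -/
noncomputable def annealedFiltration (d : ℕ) :
    Filtration ℝ≥0 (inferInstance : MeasurableSpace (Env d × PathSpace d)) where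
  seq t := MeasurableSpace.prod inferInstance (walkFiltration d t)
  mono' _ _ hst :=
    sup_le_sup le_rfl (MeasurableSpace.comap_mono ((walkFiltration d).mono hst))
  le' t := sup_le_sup le_rfl (MeasurableSpace.comap_mono ((walkFiltration d).le t))

/-! ### Predictable quadratic variation -/

/-- `A` is the predictable quadratic variation `⟨N⟩` of the càdlàg square-integrable martingale
`N`: it is the predictable, nondecreasing, càdlàg process with `A 0 = 0` such that `N² - A` is a
martingale (by the Doob-Meyer theorem, these properties determine it up to
indistinguishability). -/
structure IsPredictableQuadraticVariation {S : Type*} {mS : MeasurableSpace S}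
    (N A : ℝ≥0 → S → ℝ) (ℱ : Filtration ℝ≥0 mS) (Q : Measure S) : Prop where
  martingale : Martingale N ℱ Q
  memLp : ∀ t, MemLp (N t) 2 Q
  cadlag : ∀ᵐ η ∂Q, IsCadlag fun t => N t η
  predictable : IsStronglyPredictable ℱ A
  zero : ∀ᵐ η ∂Q, A 0 η = 0
  monotone : ∀ᵐ η ∂Q, Monotone fun t => A t η
  cadlag_bracket : ∀ᵐ η ∂Q, IsCadlag fun t => A t η
  martingale_sq_sub : Martingale (fun t η => N t η ^ 2 - A t η) ℱ Q

end RandomConductance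

open RandomConductance

namespace RandomConductance

/-! ### Càdlàg paths in discrete spaces -/

/-! The key object is the corrected coordinate `F(x, ω) = ξ·x + φ(θ_x ω) - φ(ω)` (`correctedCoord`).
Its increments from `x` see only `θ_x ω`, so the resolvent equation and shift invariance of `P`
give, for almost every `ω` and all `x`, `L^ω F(x) = μ φ(θ_x ω)`. Hence `M_μ(t) = F(X_t) - B_t` with
`B_t = ∫_0^t b_r dr`, `b_r = μ φ(ω(r))`, is the Dynkin process of `F`.

For the square, the carré du champ identity `v_μ(θ_x ω) = L^ω F² - 2 F L^ω F` and `B_t² = 2 ∫_0^t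
B_r b_r dr` yield `M² - A = (F²(X) - ∫ L^ω F² dr) - 2 (M B - ∫ M b dr)` (`martingalePart_sq_sub`).
The first bracket is the Dynkin process of `F²`, and the second is a martingale by Fubini and the
martingale property of `M` (`setIntegral_mul_sub_integral`).

The work lies in Dynkin's formula for unbounded `F` and `F²`, with `φ` merely in `L²`. Since the
jump rates are bounded by some `Λ`, the operator `L^ω + Λ` is positive, and everything is first
proved for functions with values in `[0, ∞]`, without integrability: the transition function equals
the uniformized semigroup (`IsTransitionFunction.ofReal_eq_walkSemigroup`), which satisfies the
integrated Kolmogorov equation (`walkSemigroup_add_lintegral`), and the Markov property turns this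
into `annealed_dynkin`. Integrability is then needed only to subtract the `Λ` terms
(`setIntegral_dynkinPart`). It comes from one dominating function for both `|F|` and `F²`, whose
terms are controlled by a Lyapunov bound for `(ξ·x)²` (`momentBound_dot`) and by stationarity of the
environment seen from the particle (`annealed_lintegral_environment`). -/

theorem IsCadlag.comp_of_discrete {E F : Type*} [TopologicalSpace E] [DiscreteTopology E]
    [TopologicalSpace F] {γ : ℝ≥0 → E} (h : IsCadlag γ) (g : E → F) :
    IsCadlag fun t => g (γ t) := by
  intro t
  obtain ⟨h1, l, hl⟩ := h t
  exact ⟨(continuous_of_discreteTopology (f := g)).continuousAt.comp_continuousWithinAt h1, g l,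
    ((continuous_of_discreteTopology (f := g)).tendsto l).comp hl⟩

theorem isCadlag_of_continuous {F : Type*} [TopologicalSpace F] {f : ℝ≥0 → F}
    (hf : Continuous f) : IsCadlag f := fun t =>
  ⟨hf.continuousWithinAt, f t, hf.continuousAt.mono_left nhdsWithin_le_nhds⟩

theorem IsCadlag.add {f g : ℝ≥0 → ℝ} (hf : IsCadlag f) (hg : IsCadlag g) :
    IsCadlag fun t => f t + g t := fun t => by
  obtain ⟨h1, l, hl⟩ := hf t
  obtain ⟨h2, k, hk⟩ := hg t
  exact ⟨h1.add h2, l + k, hl.add hk⟩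

/-- Near each time `t` a càdlàg path in a discrete space takes at most two values, `γ t` and its
left limit; compactness does the rest. This makes every function of the walk bounded along a path on
compact time intervals. -/
theorem IsCadlag.finite_image {E : Type*} [TopologicalSpace E] [DiscreteTopology E]
    {γ : ℝ≥0 → E} (h : IsCadlag γ) {K : Set ℝ≥0} (hK : IsCompact K) : (γ '' K).Finite := by
  refine hK.induction_on (p := fun s => (γ '' s).Finite) (by simp)
    (fun s t hst ht => ht.subset (image_mono hst))
    (fun s t hs ht => by rw [image_union]; exact hs.union ht) fun t _ => ?_
  obtain ⟨h1, l, hl⟩ := h t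
  have h1' : ∀ᶠ s in 𝓝[≥] t, γ s = γ t := (h1.eventually (mem_nhds_discrete.2 (mem_singleton _)) :)
  have h2' : ∀ᶠ s in 𝓝[<] t, γ s = l := hl.eventually (mem_nhds_discrete.2 (mem_singleton _))
  have h3 : ∀ᶠ s in 𝓝 t, γ s = γ t ∨ γ s = l := by
    rw [← nhdsLT_sup_nhdsGE t]
    exact eventually_sup.2 ⟨h2'.mono fun _ => Or.inr, h1'.mono fun _ => Or.inl⟩
  refine ⟨_, nhdsWithin_le_nhds h3, ((finite_singleton (γ t)).union (finite_singleton l)).subset ?_⟩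
  rintro _ ⟨s, hs, rfl⟩
  exact hs

/-! ### Measurability and time integrals of functionals of the walk -/

variable {d : ℕ}

theorem eventually_walk_toNNReal_eq (γ : PathSpace d) (r : ℝ) :
    ∀ᶠ u in 𝓝[≥] r, walk u.toNNReal γ = walk r.toNNReal γ := by
  have h1 := (γ.2 r.toNNReal).1.tendsto.eventually (mem_nhds_discrete.2 (mem_singleton _))
  have h2 : Tendsto Real.toNNReal (𝓝[≥] r) (𝓝[≥] r.toNNReal) :=
    tendsto_nhdsWithin_iff.2 ⟨continuous_real_toNNReal.continuousAt.mono_left nhdsWithin_le_nhds,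
      eventually_mem_nhdsWithin.mono fun u hu => Real.toNNReal_mono hu⟩
  exact h2.eventually h1

/-- Progressive measurability of the canonical process, with the time capped at `t`. -/
theorem measurable_walk_min (t : ℝ≥0) :
    Measurable[(inferInstance : MeasurableSpace ℝ).prod (walkFiltration d t)]
      fun q : ℝ × PathSpace d => walk (min q.1.toNNReal t) q.2 := by
  let _ : MeasurableSpace (PathSpace d) := walkFiltration d t
  -- The `+ 1` puts the grid time strictly to the right of `r`, so right-continuity gives
  -- convergence; capping at `t` keeps each approximation measurable with respect to the past of
  -- `t`.
  set a : ℕ → ℝ → ℝ≥0 := fun n r => min (((⌊((n : ℝ) + 1) * r⌋₊ : ℝ≥0) + 1) / (n + 1)) t with ha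
  have hmeas : ∀ n, Measurable fun q : ℝ × PathSpace d => walk (a n q.1) q.2 := by
    intro n
    have h1 : Measurable fun q : ℕ × PathSpace d =>
        walk (min (((q.1 : ℝ≥0) + 1) / (n + 1)) t) q.2 := by
      refine measurable_from_prod_countable_right fun k => ?_
      have := ((Filtration.stronglyAdapted_natural
        (fun t => (measurable_walk (d := d) t).stronglyMeasurable)
          (min (((k : ℝ≥0) + 1) / (n + 1)) t)).mono
            ((walkFiltration d).mono (min_le_right _ t))).measurable
      exact this
    refine h1.comp (f := fun q : ℝ × PathSpace d => (⌊((n : ℝ) + 1) * q.1⌋₊, q.2)) ?_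
    exact (Nat.measurable_floor.comp (measurable_fst.const_mul _)).prodMk measurable_snd
  refine measurable_of_tendsto_metrizable' atTop hmeas (tendsto_pi_nhds.2 fun q => ?_)
  obtain ⟨r, γ⟩ := q
  have hlow : ∀ n : ℕ, (r.toNNReal : ℝ) ≤
      (((⌊((n : ℝ) + 1) * r⌋₊ : ℝ≥0) + 1) / (n + 1) : ℝ≥0) := by
    intro n
    push_cast
    rw [Real.coe_toNNReal', le_div_iff₀ (by positivity)]
    rcases le_total r 0 with h | h
    · rw [max_eq_right h, zero_mul]; positivity
    · rw [max_eq_left h, mul_comm]; exact (Nat.lt_floor_add_one _).le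
  refine (γ.2 (min r.toNNReal t)).1.tendsto.comp (tendsto_nhdsWithin_iff.2 ⟨?_, ?_⟩)
  · refine Tendsto.min ?_ tendsto_const_nhds
    rw [← NNReal.tendsto_coe]
    have hup : ∀ n : ℕ, ((((⌊((n : ℝ) + 1) * r⌋₊ : ℝ≥0) + 1) / (n + 1) : ℝ≥0) : ℝ)
        ≤ r.toNNReal + 1 / ((n : ℝ) + 1) := by
      intro n
      rw [Real.coe_toNNReal']
      push_cast
      rw [div_le_iff₀ (by positivity), add_mul (max r 0), one_div_mul_cancel (by positivity)]
      gcongr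
      rcases le_total r 0 with h | h
      · rw [max_eq_right h, Nat.floor_of_nonpos
          (mul_nonpos_of_nonneg_of_nonpos (by positivity) h)]
        simp
      · rw [max_eq_left h, mul_comm r]; exact Nat.floor_le (by positivity)
    refine tendsto_of_tendsto_of_tendsto_of_le_of_le tendsto_const_nhds ?_ hlow hup
    simpa using (tendsto_const_nhds (x := (r.toNNReal : ℝ))).add
      (tendsto_one_div_add_atTop_nhds_zero_nat (𝕜 := ℝ))
  · refine Eventually.of_forall fun n => ?_
    exact min_le_min_right t (NNReal.coe_le_coe.1 (hlow n))

theorem measurable_walk_toNNReal :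
    Measurable fun q : ℝ × PathSpace d => walk q.1.toNNReal q.2 := by
  have h : ∀ n : ℕ, Measurable fun q : ℝ × PathSpace d => walk (min q.1.toNNReal n) q.2 :=
    fun n => (measurable_walk_min (n : ℝ≥0)).mono
      (sup_le_sup le_rfl (MeasurableSpace.comap_mono ((walkFiltration d).le _))) le_rfl
  refine measurable_of_tendsto_metrizable' atTop h (tendsto_pi_nhds.2 fun q => ?_)
  refine tendsto_const_nhds.congr' ?_
  filter_upwards [eventually_ge_atTop ⌈q.1.toNNReal⌉₊] with n hn
  rw [min_eq_left (Nat.ceil_le.1 hn)]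

theorem measurable_comp_walk_min {E : Type*} [MeasurableSpace E] {F : Zd d → Env d → E}
    (hF : ∀ x, Measurable (F x)) (t : ℝ≥0) :
    Measurable[(inferInstance : MeasurableSpace ℝ).prod (annealedFiltration d t)]
      fun q : ℝ × (Env d × PathSpace d) => F (walk (min q.1.toNNReal t) q.2.2) q.2.1 := by
  let _ : MeasurableSpace (PathSpace d) := walkFiltration d t
  have h1 : Measurable fun q : Zd d × Env d => F q.1 q.2 :=
    measurable_from_prod_countable_right hF
  have h2 : Measurable fun q : ℝ × (Env d × PathSpace d) =>
      (walk (min q.1.toNNReal t) q.2.2, q.2.1) :=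
    ((measurable_walk_min t).comp
      (measurable_fst.prodMk (measurable_snd.comp measurable_snd))).prodMk (measurable_fst.comp measurable_snd)
  exact h1.comp h2

theorem measurable_comp_walk_toNNReal {E : Type*} [MeasurableSpace E] {F : Zd d → Env d → E}
    (hF : ∀ x, Measurable (F x)) :
    Measurable fun q : ℝ × (Env d × PathSpace d) => F (walk q.1.toNNReal q.2.2) q.2.1 := by
  have h1 : Measurable fun q : Zd d × Env d => F q.1 q.2 :=
    measurable_from_prod_countable_right hF
  have h2 : Measurable fun q : ℝ × (Env d × PathSpace d) => (walk q.1.toNNReal q.2.2, q.2.1) :=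
    (measurable_walk_toNNReal.comp
      (measurable_fst.prodMk (measurable_snd.comp measurable_snd))).prodMk (measurable_fst.comp measurable_snd)
  exact h1.comp h2

theorem measurable_comp_walk {E : Type*} [MeasurableSpace E] {F : Zd d → Env d → E}
    (hF : ∀ x, Measurable (F x)) (t : ℝ≥0) :
    Measurable[annealedFiltration d t]
      fun η : Env d × PathSpace d => F (walk t η.2) η.1 := by
  let _ : MeasurableSpace (Env d × PathSpace d) := annealedFiltration d t
  have h := (measurable_comp_walk_min hF t).comp
    (measurable_prodMk_left (x := (t : ℝ)) (β := Env d × PathSpace d))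
  simpa [Function.comp_def] using h

/-- No growth condition on `g` is needed: the path visits finitely many sites on a bounded time
interval. Negative times are read as time `0`. -/
theorem intervalIntegrable_comp_walk (g : Zd d → ℝ) (γ : PathSpace d) (a b : ℝ) :
    IntervalIntegrable (fun r => g (walk r.toNNReal γ)) volume a b := by
  rw [intervalIntegrable_iff]
  have hfin : (γ.1 '' Icc 0 (max a b).toNNReal).Finite := γ.2.finite_image isCompact_Icc
  obtain ⟨C, hC⟩ := ((hfin.image fun x => ‖g x‖).bddAbove)
  refine Measure.integrableOn_of_bounded (M := C) (by simp [uIoc]) ?_ ?_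
  · exact ((measurable_of_countable g).comp
      (measurable_walk_toNNReal.comp measurable_prodMk_right)).aestronglyMeasurable
  · refine (ae_restrict_iff' measurableSet_uIoc).2 (Eventually.of_forall fun r hr => ?_)
    exact hC ⟨_, ⟨_, ⟨zero_le, Real.toNNReal_mono hr.2⟩, rfl⟩, rfl⟩

theorem continuous_integral_walk (g : Zd d → ℝ) (γ : PathSpace d) :
    Continuous fun t : ℝ≥0 => ∫ r in (0 : ℝ)..t, g (walk r.toNNReal γ) :=
  (intervalIntegral.continuous_primitive (intervalIntegrable_comp_walk g γ) 0).comp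
    NNReal.continuous_coe

theorem measurable_integral_walk {F : Zd d → Env d → ℝ} (hF : ∀ x, Measurable (F x)) (t : ℝ≥0) :
    Measurable[annealedFiltration d t]
      fun η : Env d × PathSpace d => ∫ r in (0 : ℝ)..t, F (walk r.toNNReal η.2) η.1 := by
  let _ : MeasurableSpace (Env d × PathSpace d) := annealedFiltration d t
  have h := ((measurable_comp_walk_min hF t).comp
    measurable_swap).stronglyMeasurable.integral_prod_right'
      (ν := (volume : Measure ℝ).restrict (Ioc 0 (t : ℝ)))
  convert h.measurable using 1
  funext η
  rw [intervalIntegral.integral_of_le t.coe_nonneg]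
  refine setIntegral_congr_fun measurableSet_Ioc fun r hr => ?_
  have : r.toNNReal ≤ t := Real.toNNReal_le_iff_le_coe.2 hr.2
  simp [min_eq_left this]

/-- Continuity allows sampling from the left: the sampled process is constant in time on each
`(k/(n+1), (k+1)/(n+1)]`, with a value known at the left endpoint, hence built from generators of
the predictable σ-algebra. -/
theorem isStronglyPredictable_of_continuous {S : Type*} {mS : MeasurableSpace S}
    {ℱ : Filtration ℝ≥0 mS} {A : ℝ≥0 → S → ℝ} (hA : ∀ t, Measurable[ℱ t] (A t))
    (hc : ∀ η, Continuous fun t => A t η) : IsStronglyPredictable ℱ A := by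
  let _ : MeasurableSpace (ℝ≥0 × S) := ℱ.predictable
  -- For `t > 0` this is the last grid point strictly before `t`; at `t = 0` the truncated
  -- subtraction returns `0`, which is the separate piece `{⊥}` of the decomposition below.
  set a : ℕ → ℝ≥0 → ℝ≥0 := fun n t => ((⌈((n : ℝ≥0) + 1) * t⌉₊ - 1 : ℕ) : ℝ≥0) / (n + 1) with ha
  have hmeas : ∀ n, Measurable fun q : ℝ≥0 × S => A (a n q.1) q.2 := by
    intro n B hB
    have h0 : (fun q : ℝ≥0 × S => A (a n q.1) q.2) ⁻¹' B = {⊥} ×ˢ (A 0 ⁻¹' B) ∪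
        ⋃ k : ℕ, Ioc ((k : ℝ≥0) / (n + 1)) (((k : ℝ≥0) + 1) / (n + 1)) ×ˢ
          (A ((k : ℝ≥0) / (n + 1)) ⁻¹' B) := by
      have hk : ∀ (k : ℕ) (t : ℝ≥0), t ∈ Ioc ((k : ℝ≥0) / (n + 1)) (((k : ℝ≥0) + 1) / (n + 1)) ↔
          ⌈((n : ℝ≥0) + 1) * t⌉₊ = k + 1 := by
        intro k t
        rw [Nat.ceil_eq_iff (by simp), mem_Ioc, div_lt_iff₀ (by positivity),
          le_div_iff₀ (by positivity), mul_comm t]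
        simp
      ext ⟨t, η⟩
      simp only [mem_preimage, mem_union, mem_prod, mem_singleton_iff, mem_iUnion]
      constructor
      · intro h
        rcases eq_or_ne t 0 with rfl | ht
        · left; simpa [ha] using h
        · right
          have hpos : 0 < ⌈((n : ℝ≥0) + 1) * t⌉₊ := Nat.ceil_pos.2 (by positivity)
          refine ⟨⌈((n : ℝ≥0) + 1) * t⌉₊ - 1, (hk _ _).2 (by omega), h⟩
      · rintro (⟨rfl, h⟩ | ⟨k, hkt, h⟩)
        · simpa [ha] using h
        · have := (hk k t).1 hkt
          simpa [ha, this] using h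
    rw [h0]
    refine (measurableSet_predictable_singleton_bot_prod (hA 0 hB)).union
      (MeasurableSet.iUnion fun k => measurableSet_predictable_Ioc_prod _ _ (hA _ hB))
  refine (measurable_of_tendsto_metrizable' atTop hmeas
    (tendsto_pi_nhds.2 fun q => ?_)).stronglyMeasurable
  refine ((hc q.2).tendsto q.1).comp ?_
  rw [← NNReal.tendsto_coe]
  have hlow : ∀ n : ℕ, (q.1 : ℝ) - 1 / ((n : ℝ) + 1) ≤ (a n q.1 : ℝ) := by
    intro n
    simp only [ha, NNReal.coe_div, NNReal.coe_natCast, NNReal.coe_add, NNReal.coe_one]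
    rw [le_div_iff₀ (by positivity), sub_mul, one_div, inv_mul_cancel₀ (by positivity),
      sub_le_iff_le_add, mul_comm]
    have h1 : ((n : ℝ) + 1) * q.1 ≤ ⌈((n : ℝ≥0) + 1) * q.1⌉₊ := by
      exact_mod_cast Nat.le_ceil (((n : ℝ≥0) + 1) * q.1)
    have h2 : ((⌈((n : ℝ≥0) + 1) * q.1⌉₊ : ℕ) : ℝ) ≤
        ((⌈((n : ℝ≥0) + 1) * q.1⌉₊ - 1 : ℕ) : ℝ) + 1 := by
      exact_mod_cast (by omega)
    exact h1.trans h2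
  have hup : ∀ n : ℕ, (a n q.1 : ℝ) ≤ q.1 := by
    intro n
    rw [NNReal.coe_le_coe]
    simp only [ha]
    rw [div_le_iff₀ (by positivity), mul_comm q.1]
    rcases Nat.eq_zero_or_pos ⌈((n : ℝ≥0) + 1) * q.1⌉₊ with h | h
    · rw [h]; simp
    · exact (Nat.lt_ceil.1 (Nat.sub_lt h one_pos)).le
  refine tendsto_of_tendsto_of_tendsto_of_le_of_le ?_ tendsto_const_nhds hlow hup
  simpa using (tendsto_const_nhds (x := (q.1 : ℝ))).sub
    (tendsto_one_div_add_atTop_nhds_zero_nat (𝕜 := ℝ))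

end RandomConductance

namespace RandomConductance

variable {d : ℕ}

/-! ### The uniformized walk semigroup -/

theorem conductance_nonneg (ω : Env d) (x y : Zd d) : 0 ≤ conductance ω x y := by
  unfold conductance
  split_ifs with h
  · exact (ω ⟨s(x, y), h⟩).2.le
  · exact le_rfl

theorem measurable_conductance (x y : Zd d) :
    Measurable fun ω : Env d => conductance ω x y := by
  unfold conductance
  split_ifs with h
  · exact measurable_subtype_coe.comp (measurable_pi_apply _)
  · exact measurable_const

/-- The total jump rates of the environment `ω` are bounded by `Λ`. -/
def RateBound (Λ : ℝ) (ω : Env d) : Prop :=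
  ∀ x, ∑ z ∈ unitVectors d, conductance ω x (x + z) ≤ Λ

/-- The positive operator `L^ω + Λ`, acting on functions with values in `[0, ∞]`. -/
noncomputable def jumpOp (Λ : ℝ) (ω : Env d) (f : Zd d → ℝ≥0∞) (x : Zd d) : ℝ≥0∞ :=
  ∑ z ∈ unitVectors d, ENNReal.ofReal (conductance ω x (x + z)) * f (x + z)
    + ENNReal.ofReal (Λ - ∑ z ∈ unitVectors d, conductance ω x (x + z)) * f x

/-- The coefficient `e^{-Λ t} t^n / n!`. -/
noncomputable def poissonWeight (Λ t : ℝ) (n : ℕ) : ℝ :=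
  Real.exp (-(Λ * t)) * (t ^ n / n.factorial)

/-- The semigroup `e^{t L^ω} = e^{-Λ t} ∑_n t^n (L^ω + Λ)^n / n!`, acting on functions with values
in `[0, ∞]`. -/
noncomputable def walkSemigroup (Λ : ℝ) (ω : Env d) (t : ℝ) (f : Zd d → ℝ≥0∞) (x : Zd d) :
    ℝ≥0∞ :=
  ∑' n, ENNReal.ofReal (poissonWeight Λ t n) * (jumpOp Λ ω)^[n] f x

variable {Λ : ℝ} {ω : Env d}

theorem poissonWeight_nonneg {t : ℝ} (ht : 0 ≤ t) (n : ℕ) : 0 ≤ poissonWeight Λ t n := by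
  unfold poissonWeight; positivity

theorem continuous_poissonWeight (n : ℕ) : Continuous fun t => poissonWeight Λ t n := by
  unfold poissonWeight; fun_prop

theorem poissonWeight_zero_left (n : ℕ) : poissonWeight Λ 0 n = if n = 0 then 1 else 0 := by
  unfold poissonWeight
  rcases n with _ | n <;> simp

theorem hasDerivAt_exp_mul (c t : ℝ) :
    HasDerivAt (fun t => Real.exp (c * t)) (c * Real.exp (c * t)) t := by
  simpa [mul_comm] using ((hasDerivAt_id t).const_mul c).exp

theorem hasDerivAt_poissonWeight_zero (t : ℝ) :
    HasDerivAt (fun t => poissonWeight Λ t 0) (-(Λ * poissonWeight Λ t 0)) t := by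
  unfold poissonWeight
  simpa using hasDerivAt_exp_mul (-Λ) t

theorem hasDerivAt_poissonWeight_succ (t : ℝ) (n : ℕ) :
    HasDerivAt (fun t => poissonWeight Λ t (n + 1))
      (poissonWeight Λ t n - Λ * poissonWeight Λ t (n + 1)) t := by
  unfold poissonWeight
  have h := (hasDerivAt_exp_mul (-Λ) t).fun_mul
    ((hasDerivAt_pow (n + 1) t).div_const ((n + 1).factorial : ℝ))
  simp only [neg_mul] at h
  refine h.congr_deriv ?_
  have : ((n + 1).factorial : ℝ) = (n + 1) * n.factorial := by
    rw [Nat.factorial_succ]; push_cast; ring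
  have h1 : (n.factorial : ℝ) ≠ 0 := by positivity
  have h2 : (n : ℝ) + 1 ≠ 0 := by positivity
  simp only [this, Nat.cast_add, Nat.cast_one, Nat.add_sub_cancel]
  field_simp
  ring

theorem lintegral_poissonWeight (hΛ : 0 ≤ Λ) {t : ℝ} (ht : 0 ≤ t) (n : ℕ) :
    ENNReal.ofReal Λ * ∫⁻ r in Ioc 0 t, ENNReal.ofReal (poissonWeight Λ r n)
      = ENNReal.ofReal (∫ r in (0 : ℝ)..t, Λ * poissonWeight Λ r n) ∧
    ∫⁻ r in Ioc 0 t, ENNReal.ofReal (poissonWeight Λ r n)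
      = ENNReal.ofReal (∫ r in (0 : ℝ)..t, poissonWeight Λ r n) := by
  have h2 : ∫⁻ r in Ioc 0 t, ENNReal.ofReal (poissonWeight Λ r n)
      = ENNReal.ofReal (∫ r in (0 : ℝ)..t, poissonWeight Λ r n) := by
    rw [intervalIntegral.integral_of_le ht, ofReal_integral_eq_lintegral_ofReal]
    · exact (continuous_poissonWeight n).integrableOn_Ioc
    · exact (ae_restrict_iff' measurableSet_Ioc).2
        (Eventually.of_forall fun r hr => poissonWeight_nonneg hr.1.le n)
  refine ⟨?_, h2⟩
  rw [h2, intervalIntegral.integral_const_mul, ENNReal.ofReal_mul hΛ]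

/-- The equation `p_0' = -Λ p_0` in integrated form. Here and in the next lemma the negative term
sits on the left, so that the identity survives multiplication by a possibly infinite number. -/
theorem poissonWeight_zero_add_lintegral (hΛ : 0 ≤ Λ) {t : ℝ} (ht : 0 ≤ t) :
    ENNReal.ofReal (poissonWeight Λ t 0)
      + ENNReal.ofReal Λ * ∫⁻ r in Ioc 0 t, ENNReal.ofReal (poissonWeight Λ r 0) = 1 := by
  have hc := (continuous_poissonWeight (Λ := Λ) 0)
  have h : ∫ r in (0 : ℝ)..t, -(Λ * poissonWeight Λ r 0) = poissonWeight Λ t 0 - 1 := by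
    rw [intervalIntegral.integral_eq_sub_of_hasDerivAt
      (fun r _ => hasDerivAt_poissonWeight_zero r)
      ((continuous_const.mul hc).neg.intervalIntegrable _ _), poissonWeight_zero_left]
    simp
  rw [intervalIntegral.integral_neg] at h
  have h0 : 0 ≤ ∫ r in (0 : ℝ)..t, Λ * poissonWeight Λ r 0 :=
    intervalIntegral.integral_nonneg ht fun r hr => mul_nonneg hΛ (poissonWeight_nonneg hr.1 _)
  rw [(lintegral_poissonWeight hΛ ht 0).1, ← ENNReal.ofReal_add (poissonWeight_nonneg ht _) h0,
    ← ENNReal.ofReal_one]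
  congr 1
  linarith

theorem poissonWeight_succ_add_lintegral (hΛ : 0 ≤ Λ) {t : ℝ} (ht : 0 ≤ t) (n : ℕ) :
    ENNReal.ofReal (poissonWeight Λ t (n + 1))
      + ENNReal.ofReal Λ * ∫⁻ r in Ioc 0 t, ENNReal.ofReal (poissonWeight Λ r (n + 1))
      = ∫⁻ r in Ioc 0 t, ENNReal.ofReal (poissonWeight Λ r n) := by
  have hc := (continuous_poissonWeight (Λ := Λ) (n + 1))
  have hc' := (continuous_poissonWeight (Λ := Λ) n)
  have h : ∫ r in (0 : ℝ)..t, (poissonWeight Λ r n - Λ * poissonWeight Λ r (n + 1))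
      = poissonWeight Λ t (n + 1) := by
    rw [intervalIntegral.integral_eq_sub_of_hasDerivAt
      (fun r _ => hasDerivAt_poissonWeight_succ r n)
      ((hc'.sub (continuous_const.mul hc)).intervalIntegrable _ _), poissonWeight_zero_left]
    simp
  rw [intervalIntegral.integral_sub (hc'.intervalIntegrable _ _)
    ((hc.const_mul Λ).intervalIntegrable _ _)] at h
  have h0 : 0 ≤ ∫ r in (0 : ℝ)..t, Λ * poissonWeight Λ r (n + 1) :=
    intervalIntegral.integral_nonneg ht fun r hr => mul_nonneg hΛ (poissonWeight_nonneg hr.1 _)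
  rw [(lintegral_poissonWeight hΛ ht _).1, (lintegral_poissonWeight hΛ ht n).2,
    ← ENNReal.ofReal_add (poissonWeight_nonneg ht _) h0]
  congr 1
  linarith

/-- The exponential series. With `K = Λ` it gives total mass one; general `K` gives the growth rate
`K - Λ` in the Lyapunov bound. -/
theorem tsum_poissonWeight_mul_pow {K t : ℝ} (hK : 0 ≤ K) (ht : 0 ≤ t) :
    ∑' n, ENNReal.ofReal (poissonWeight Λ t n) * ENNReal.ofReal K ^ n
      = ENNReal.ofReal (Real.exp ((K - Λ) * t)) := by
  have h1 : ∀ n, ENNReal.ofReal (poissonWeight Λ t n) * ENNReal.ofReal K ^ n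
      = ENNReal.ofReal (Real.exp (-(Λ * t)) * ((K * t) ^ n / n.factorial)) := fun n => by
    rw [← ENNReal.ofReal_pow hK, ← ENNReal.ofReal_mul (poissonWeight_nonneg ht n)]
    congr 1
    unfold poissonWeight
    rw [mul_pow]; ring
  have h2 := (NormedSpace.expSeries_div_hasSum_exp (K * t)).mul_left (Real.exp (-(Λ * t)))
  rw [← Real.exp_eq_exp_ℝ, ← Real.exp_add] at h2
  simp_rw [h1]
  rw [← ENNReal.ofReal_tsum_of_nonneg (fun n => by positivity) h2.summable, h2.tsum_eq]
  congr 2; ring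

/-! ### Linearity and monotonicity of `jumpOp` -/

theorem jumpOp_tsum {ι : Type*} (c : ι → ℝ≥0∞) (f : ι → Zd d → ℝ≥0∞) :
    jumpOp Λ ω (fun x => ∑' i, c i * f i x) = fun x => ∑' i, c i * jumpOp Λ ω (f i) x := by
  funext x
  simp only [jumpOp, ← ENNReal.tsum_mul_left, mul_add, Finset.mul_sum]
  rw [ENNReal.tsum_add, Summable.tsum_finsetSum fun _ _ => ENNReal.summable]
  simp only [mul_left_comm]

theorem jumpOp_mono {f g : Zd d → ℝ≥0∞} (h : f ≤ g) : jumpOp Λ ω f ≤ jumpOp Λ ω g := by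
  intro x
  unfold jumpOp
  gcongr <;> exact h _

theorem iterate_jumpOp_tsum {ι : Type*} (c : ι → ℝ≥0∞) (f : ι → Zd d → ℝ≥0∞) (n : ℕ) :
    (jumpOp Λ ω)^[n] (fun x => ∑' i, c i * f i x)
      = fun x => ∑' i, c i * (jumpOp Λ ω)^[n] (f i) x := by
  induction n with
  | zero => rfl
  | succ n ih => simp only [Function.iterate_succ_apply', ih, jumpOp_tsum]

theorem jumpOp_const_mul (c : ℝ≥0∞) (f : Zd d → ℝ≥0∞) :
    jumpOp Λ ω (fun x => c * f x) = fun x => c * jumpOp Λ ω f x := by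
  simpa using jumpOp_tsum (Λ := Λ) (ω := ω) (fun _ : Unit => c) (fun _ => f)

/-- The rate bound keeps the diagonal coefficient `Λ - ∑ ω` from being truncated by
`ENNReal.ofReal`, so the coefficients add up to exactly `Λ`. -/
theorem jumpOp_const (h : RateBound Λ ω) (c : ℝ≥0∞) :
    jumpOp Λ ω (fun _ => c) = fun _ => ENNReal.ofReal Λ * c := by
  funext x
  unfold jumpOp
  rw [← Finset.sum_mul, ← add_mul, ← ENNReal.ofReal_sum_of_nonneg
    (fun _ _ => conductance_nonneg _ _ _), ← ENNReal.ofReal_add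
    (Finset.sum_nonneg fun _ _ => conductance_nonneg _ _ _) (sub_nonneg.2 (h x)), add_sub_cancel]

theorem iterate_jumpOp_le {f : Zd d → ℝ≥0∞} {K : ℝ≥0∞}
    (h : ∀ x, jumpOp Λ ω f x ≤ K * f x) (n : ℕ) (x : Zd d) :
    (jumpOp Λ ω)^[n] f x ≤ K ^ n * f x := by
  induction n generalizing x with
  | zero => simp
  | succ n ih =>
    rw [Function.iterate_succ_apply']
    calc jumpOp Λ ω ((jumpOp Λ ω)^[n] f) x ≤ jumpOp Λ ω (fun x => K ^ n * f x) x :=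
          jumpOp_mono ih x
      _ = K ^ n * jumpOp Λ ω f x := by rw [jumpOp_const_mul]
      _ ≤ K ^ n * (K * f x) := by gcongr; exact h x
      _ = K ^ (n + 1) * f x := by ring

/-- A Lyapunov estimate: the hypothesis says `L^ω f ≤ (K - Λ) f` in a form that makes sense in `[0,
∞]`, and it iterates because `jumpOp` is monotone and homogeneous. -/
theorem walkSemigroup_le {f : Zd d → ℝ≥0∞} {K t : ℝ} (hK : 0 ≤ K) (ht : 0 ≤ t)
    (h : ∀ x, jumpOp Λ ω f x ≤ ENNReal.ofReal K * f x) (x : Zd d) :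
    walkSemigroup Λ ω t f x ≤ ENNReal.ofReal (Real.exp ((K - Λ) * t)) * f x := by
  rw [← tsum_poissonWeight_mul_pow hK ht, ← ENNReal.tsum_mul_right]
  refine ENNReal.tsum_le_tsum fun n => ?_
  rw [mul_assoc]
  gcongr
  exact iterate_jumpOp_le h n x

theorem walkSemigroup_one (hΛ : 0 ≤ Λ) (h : RateBound Λ ω) {t : ℝ} (ht : 0 ≤ t) (x : Zd d) :
    walkSemigroup Λ ω t (fun _ => 1) x = 1 := by
  have h1 : ∀ n, (jumpOp Λ ω)^[n] (fun _ => 1) = fun _ => ENNReal.ofReal Λ ^ n := by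
    intro n
    induction n with
    | zero => simp
    | succ n ih => rw [Function.iterate_succ_apply', ih, jumpOp_const h, pow_succ']
  simp only [walkSemigroup, h1]
  rw [tsum_poissonWeight_mul_pow hΛ ht]
  simp

theorem tsum_mul_single (f : Zd d → ℝ≥0∞) (x : Zd d) :
    ∑' y, f y * (Pi.single y 1 : Zd d → ℝ≥0∞) x = f x := by
  rw [tsum_eq_single x fun y hy => by simp [hy.symm]]
  simp

/-- Reduces a general function to point masses, the only functions on which transition functions and
the Markov property are given. -/
theorem walkSemigroup_eq_tsum (t : ℝ) (f : Zd d → ℝ≥0∞) (x : Zd d) :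
    walkSemigroup Λ ω t f x = ∑' y, f y * walkSemigroup Λ ω t (Pi.single y 1) x := by
  have h : ∀ n, (jumpOp Λ ω)^[n] f x = ∑' y, f y * (jumpOp Λ ω)^[n] (Pi.single y 1) x := by
    intro n
    conv_lhs => rw [show f = fun x => ∑' y, f y * (Pi.single y 1 : Zd d → ℝ≥0∞) x from
      funext fun x => (tsum_mul_single f x).symm]
    rw [iterate_jumpOp_tsum]
  simp only [walkSemigroup, h, ← ENNReal.tsum_mul_left]
  rw [ENNReal.tsum_comm]
  simp only [mul_left_comm]

theorem measurable_walkSemigroup (f : Zd d → ℝ≥0∞) (x : Zd d) :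
    Measurable fun t => walkSemigroup Λ ω t f x := by
  refine Measurable.tsum fun n => ?_
  exact ((continuous_poissonWeight n).measurable.ennreal_ofReal).mul_const _

/-- The integrated Kolmogorov equation `e^{tL} f = f + ∫_0^t e^{rL} L f dr`, for arbitrary functions
with values in `[0, ∞]`. -/
theorem walkSemigroup_add_lintegral (hΛ : 0 ≤ Λ) {t : ℝ} (ht : 0 ≤ t) (f : Zd d → ℝ≥0∞)
    (x : Zd d) :
    walkSemigroup Λ ω t f x + ENNReal.ofReal Λ * ∫⁻ r in Ioc 0 t, walkSemigroup Λ ω r f x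
      = f x + ∫⁻ r in Ioc 0 t, walkSemigroup Λ ω r (jumpOp Λ ω f) x := by
  have hI : ∀ g : Zd d → ℝ≥0∞, ∫⁻ r in Ioc 0 t, walkSemigroup Λ ω r g x
      = ∑' n, (∫⁻ r in Ioc 0 t, ENNReal.ofReal (poissonWeight Λ r n)) * (jumpOp Λ ω)^[n] g x := by
    intro g
    unfold walkSemigroup
    have hm : ∀ n, Measurable fun r => ENNReal.ofReal (poissonWeight Λ r n) :=
      fun n => (continuous_poissonWeight n).measurable.ennreal_ofReal
    rw [lintegral_tsum fun n => ((hm n).mul_const _).aemeasurable]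
    simp only [lintegral_mul_const _ (hm _)]
  rw [hI, hI, walkSemigroup, ← ENNReal.tsum_mul_left, ← ENNReal.tsum_add]
  have h : ∀ n, ENNReal.ofReal (poissonWeight Λ t n) * (jumpOp Λ ω)^[n] f x + ENNReal.ofReal Λ *
      ((∫⁻ r in Ioc 0 t, ENNReal.ofReal (poissonWeight Λ r n)) * (jumpOp Λ ω)^[n] f x)
      = (ENNReal.ofReal (poissonWeight Λ t n) + ENNReal.ofReal Λ *
        ∫⁻ r in Ioc 0 t, ENNReal.ofReal (poissonWeight Λ r n)) * (jumpOp Λ ω)^[n] f x :=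
    fun n => by ring
  simp only [h]
  -- The zeroth term has total weight one and gives `f x`; in the others the weight equation lowers
  -- the index by one, leaving the series of the semigroup applied to `jumpOp Λ ω f`.
  rw [tsum_eq_zero_add' ENNReal.summable, poissonWeight_zero_add_lintegral hΛ ht]
  simp only [poissonWeight_succ_add_lintegral hΛ ht, Function.iterate_zero, id, one_mul,
    Function.iterate_succ_apply]

/-! ### Uniqueness of the transition function -/

theorem jumpOp_ofReal (h : RateBound Λ ω) {f : Zd d → ℝ} (hf : ∀ x, 0 ≤ f x) (x : Zd d) :
    jumpOp Λ ω (fun x => ENNReal.ofReal (f x)) x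
      = ENNReal.ofReal (walkGenerator ω f x + Λ * f x) := by
  unfold jumpOp walkGenerator
  have h1 : ∀ z ∈ unitVectors d, 0 ≤ conductance ω x (x + z) * f (x + z) :=
    fun z _ => mul_nonneg (conductance_nonneg _ _ _) (hf _)
  simp only [← ENNReal.ofReal_mul (conductance_nonneg _ _ _)]
  rw [← ENNReal.ofReal_sum_of_nonneg h1, ← ENNReal.ofReal_mul (sub_nonneg.2 (h x)),
    ← ENNReal.ofReal_add (Finset.sum_nonneg h1) (mul_nonneg (sub_nonneg.2 (h x)) (hf x))]
  congr 1
  simp only [mul_sub, Finset.sum_sub_distrib, ← Finset.sum_mul]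
  ring

theorem walkGenerator_add_nonneg (h : RateBound Λ ω) {f : Zd d → ℝ} (hf : ∀ x, 0 ≤ f x)
    (x : Zd d) : 0 ≤ walkGenerator ω f x + Λ * f x := by
  have : walkGenerator ω f x + Λ * f x
      = ∑ z ∈ unitVectors d, conductance ω x (x + z) * f (x + z)
        + (Λ - ∑ z ∈ unitVectors d, conductance ω x (x + z)) * f x := by
    unfold walkGenerator
    simp only [mul_sub, Finset.sum_sub_distrib, ← Finset.sum_mul]
    ring
  rw [this]
  exact add_nonneg (Finset.sum_nonneg fun z _ => mul_nonneg (conductance_nonneg _ _ _) (hf _))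
    (mul_nonneg (sub_nonneg.2 (h x)) (hf x))

/-- Multiplying by `e^{Λt}` turns the backward equation into `q' = (L^ω + Λ) q`, whose right side is
nonnegative, so its integrated form can be stated with `lintegral`. -/
theorem exp_mul_transition (h : RateBound Λ ω) {p : ℝ → Zd d → Zd d → ℝ}
    (hp : IsTransitionFunction ω p) {t : ℝ} (ht : 0 ≤ t) (x y : Zd d) :
    ENNReal.ofReal (Real.exp (Λ * t) * p t x y) = (Pi.single y 1 : Zd d → ℝ≥0∞) x
      + ∫⁻ r in Ioc 0 t,
        jumpOp Λ ω (fun z => ENNReal.ofReal (Real.exp (Λ * r) * p r z y)) x := by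
  have hder : ∀ r, 0 ≤ r → ∀ z, HasDerivWithinAt (fun r => Real.exp (Λ * r) * p r z y)
      (walkGenerator ω (fun z => Real.exp (Λ * r) * p r z y) z
        + Λ * (Real.exp (Λ * r) * p r z y)) (Ici 0) r := by
    intro r hr z
    have h1 := ((hasDerivAt_exp_mul Λ r).hasDerivWithinAt (s := Ici 0)).fun_mul
      (hp.backward r hr z y)
    refine h1.congr_deriv ?_
    rw [add_comm, mul_assoc]
    congr 1
    simp only [walkGenerator, Finset.mul_sum]
    exact Finset.sum_congr rfl fun _ _ => by ring
  have hcont : ∀ z, ContinuousOn (fun r => Real.exp (Λ * r) * p r z y) (Ici 0) :=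
    fun z r hr => (hder r hr z).continuousWithinAt
  have hcont' : ContinuousOn (fun r => walkGenerator ω (fun z => Real.exp (Λ * r) * p r z y) x
      + Λ * (Real.exp (Λ * r) * p r x y)) (Ici 0) := by
    unfold walkGenerator
    exact (continuousOn_finsetSum _ fun z _ => continuousOn_const.mul ((hcont _).sub (hcont _))).add
      (continuousOn_const.mul (hcont x))
  have hsub : uIcc 0 t ⊆ Ici 0 := by rw [uIcc_of_le ht]; exact Icc_subset_Ici_self
  have hint : IntervalIntegrable (fun r => walkGenerator ω (fun z => Real.exp (Λ * r) * p r z y) x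
      + Λ * (Real.exp (Λ * r) * p r x y)) volume 0 t := (hcont'.mono hsub).intervalIntegrable
  have hftc := intervalIntegral.integral_eq_sub_of_hasDeriv_right ((hcont x).mono hsub)
    (fun r hr => (hder r (by rw [min_eq_left ht] at hr; exact hr.1.le) x).mono
      (fun u hu => le_trans (by rw [min_eq_left ht] at hr; exact hr.1.le) (le_of_lt hu))) hint
  have hpos : ∀ r, 0 ≤ r → ∀ z, 0 ≤ Real.exp (Λ * r) * p r z y :=
    fun r hr z => mul_nonneg (Real.exp_pos _).le (hp.nonneg r hr z y)
  have hnn : ∀ r, 0 ≤ r → 0 ≤ walkGenerator ω (fun z => Real.exp (Λ * r) * p r z y) x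
      + Λ * (Real.exp (Λ * r) * p r x y) := by
    intro r hr
    exact walkGenerator_add_nonneg h (hpos r hr) x
  have hl : ∫⁻ r in Ioc 0 t, jumpOp Λ ω (fun z => ENNReal.ofReal (Real.exp (Λ * r) * p r z y)) x
      = ENNReal.ofReal (∫ r in (0 : ℝ)..t,
        (walkGenerator ω (fun z => Real.exp (Λ * r) * p r z y) x
          + Λ * (Real.exp (Λ * r) * p r x y))) := by
    rw [intervalIntegral.integral_of_le ht, ofReal_integral_eq_lintegral_ofReal]
    · exact setLIntegral_congr_fun measurableSet_Ioc fun r hr =>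
        jumpOp_ofReal h (hpos r hr.1.le) x
    · exact (intervalIntegrable_iff_integrableOn_Ioc_of_le ht).1 hint
    · exact (ae_restrict_iff' measurableSet_Ioc).2
        (Eventually.of_forall fun r hr => hnn r hr.1.le)
  have h0 : (Pi.single y 1 : Zd d → ℝ≥0∞) x = ENNReal.ofReal (p 0 x y) := by
    rw [hp.zero, Pi.single_apply]
    split_ifs <;> simp
  rw [hl, h0, ← ENNReal.ofReal_add (hp.nonneg 0 le_rfl x y)
    (intervalIntegral.integral_nonneg ht fun r hr => hnn r hr.1), hftc]
  simp

theorem lintegral_pow_div_factorial {t : ℝ} (ht : 0 ≤ t) (n : ℕ) :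
    ∫⁻ r in Ioc 0 t, ENNReal.ofReal (r ^ n / n.factorial)
      = ENNReal.ofReal (t ^ (n + 1) / (n + 1).factorial) := by
  have h := (lintegral_poissonWeight (Λ := 0) le_rfl ht n).2
  have h' := poissonWeight_succ_add_lintegral (Λ := 0) le_rfl ht n
  simpa [poissonWeight] using h'.symm

/-- Picard iteration: substituting the bound for `n` terms into the integral equation of
`exp_mul_transition` produces the bound for `n + 1` terms, by monotonicity of `jumpOp`. Thus the
uniformized semigroup is minimal among the solutions. -/
theorem sum_iterate_jumpOp_le (h : RateBound Λ ω) {p : ℝ → Zd d → Zd d → ℝ}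
    (hp : IsTransitionFunction ω p) (n : ℕ) {t : ℝ} (ht : 0 ≤ t) (x y : Zd d) :
    ∑ k ∈ Finset.range n, ENNReal.ofReal (t ^ k / k.factorial) *
      (jumpOp Λ ω)^[k] (Pi.single y 1) x ≤ ENNReal.ofReal (Real.exp (Λ * t) * p t x y) := by
  induction n generalizing t x with
  | zero => simp
  | succ n ih =>
    rw [exp_mul_transition h hp ht, Finset.sum_range_succ', add_comm]
    have h1 : ∑ k ∈ Finset.range n, ENNReal.ofReal (t ^ (k + 1) / (k + 1).factorial) *
        (jumpOp Λ ω)^[k + 1] (Pi.single y 1) x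
        = ∫⁻ r in Ioc 0 t, jumpOp Λ ω (fun z => ∑ k ∈ Finset.range n,
          ENNReal.ofReal (r ^ k / k.factorial) * (jumpOp Λ ω)^[k] (Pi.single y 1) z) x := by
      have h2 : ∀ r : ℝ, jumpOp Λ ω (fun z => ∑ k ∈ Finset.range n,
          ENNReal.ofReal (r ^ k / k.factorial) * (jumpOp Λ ω)^[k] (Pi.single y 1) z) x
          = ∑ k ∈ Finset.range n, ENNReal.ofReal (r ^ k / k.factorial) *
            (jumpOp Λ ω)^[k + 1] (Pi.single y 1) x := by
        intro r
        have := congrFun (jumpOp_tsum (Λ := Λ) (ω := ω)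
          (fun k : Finset.range n => ENNReal.ofReal (r ^ (k : ℕ) / (k : ℕ).factorial))
          (fun k => (jumpOp Λ ω)^[k] (Pi.single y 1))) x
        rw [show (fun z => ∑ k ∈ Finset.range n, ENNReal.ofReal (r ^ k / k.factorial) *
            (jumpOp Λ ω)^[k] (Pi.single y 1) z) = _ from funext fun z =>
          (Finset.tsum_subtype (Finset.range n) (fun k => ENNReal.ofReal (r ^ k / k.factorial) *
            (jumpOp Λ ω)^[k] (Pi.single y 1) z)).symm, this,
          Finset.tsum_subtype (Finset.range n) (fun k =>
          ENNReal.ofReal (r ^ k / k.factorial) *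
            jumpOp Λ ω ((jumpOp Λ ω)^[k] (Pi.single y 1)) x)]
        simp only [Function.iterate_succ_apply']
      have hm : ∀ k : ℕ, Measurable fun r : ℝ => ENNReal.ofReal (r ^ k / k.factorial) :=
        fun k => by fun_prop
      simp only [h2]
      rw [lintegral_finsetSum _ fun k _ => (hm k).mul_const _]
      exact Finset.sum_congr rfl fun k _ => by
        rw [lintegral_mul_const _ (hm k), lintegral_pow_div_factorial ht]
    rw [h1]
    refine add_le_add (by simp) (setLIntegral_mono' measurableSet_Ioc fun r hr => ?_)
    exact jumpOp_mono (fun z => ih hr.1.le z) x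

/-- The transition function with jump rates `ω` is the uniformized semigroup. -/
theorem IsTransitionFunction.ofReal_eq_walkSemigroup (hΛ : 0 ≤ Λ) (h : RateBound Λ ω)
    {p : ℝ → Zd d → Zd d → ℝ} (hp : IsTransitionFunction ω p) {t : ℝ} (ht : 0 ≤ t) (x y : Zd d) :
    ENNReal.ofReal (p t x y) = walkSemigroup Λ ω t (Pi.single y 1) x := by
  have hle : ∀ y, walkSemigroup Λ ω t (Pi.single y 1) x ≤ ENNReal.ofReal (p t x y) := by
    intro y
    refine ENNReal.tsum_le_of_sum_range_le fun n => ?_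
    have h1 := mul_le_mul_right (sum_iterate_jumpOp_le h hp n ht x y)
      (ENNReal.ofReal (Real.exp (-(Λ * t))))
    rw [← ENNReal.ofReal_mul (Real.exp_pos _).le, ← mul_assoc, ← Real.exp_add, neg_add_cancel,
      Real.exp_zero, one_mul, Finset.mul_sum] at h1
    refine le_trans (le_of_eq (Finset.sum_congr rfl fun k _ => ?_)) h1
    rw [← mul_assoc, ← ENNReal.ofReal_mul (Real.exp_pos _).le, poissonWeight]
  have hs1 : ∑' y, walkSemigroup Λ ω t (Pi.single y 1) x = 1 := by
    have := walkSemigroup_eq_tsum (Λ := Λ) (ω := ω) t (fun _ => 1) x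
    simpa only [one_mul, walkSemigroup_one hΛ h ht, eq_comm] using this
  have hs2 : ∑' y, ENNReal.ofReal (p t x y) = 1 := by
    rw [← ENNReal.ofReal_tsum_of_nonneg (hp.nonneg t ht x) (hp.hasSum_one t ht x).summable,
      (hp.hasSum_one t ht x).tsum_eq, ENNReal.ofReal_one]
  -- Both rows have total mass one and one dominates the other entrywise; a strict inequality at a
  -- single entry would make the sums differ.
  refine le_antisymm (not_lt.1 fun hlt => ?_) (hle y)
  have := ENNReal.tsum_lt_tsum (by rw [hs1]; simp) hle hlt
  rw [hs1, hs2] at this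
  exact lt_irrefl _ this

end RandomConductance

namespace RandomConductance

variable {d : ℕ} {Λ : ℝ} {ω : Env d}

/-! ### Dynkin's formula for the quenched walk -/

/-- The conditional expectation hypothesis gives this for point masses; countable additivity over
the sites extends it to every `[0, ∞]`-valued function. -/
theorem IsWalkLaw.setLIntegral_walk_add {x : Zd d} {Q : Measure (PathSpace d)}
    (hQ : IsWalkLaw ω x Q) (hΛ : 0 ≤ Λ) (h : RateBound Λ ω) (s t : ℝ≥0)
    {C : Set (PathSpace d)} (hC : MeasurableSet[walkFiltration d s] C) (f : Zd d → ℝ≥0∞) :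
    ∫⁻ γ in C, f (walk (s + t) γ) ∂Q = ∫⁻ γ in C, walkSemigroup Λ ω t f (walk s γ) ∂Q := by
  have := hQ.isProbabilityMeasure
  obtain ⟨p, hp, hm⟩ := hQ.markov
  have hC' : MeasurableSet C := (walkFiltration d).le s _ hC
  have hpm : ∀ y, Measurable fun γ => p t (walk s γ) y :=
    fun y => (measurable_of_countable fun z => p t z y).comp (measurable_walk s)
  have hdirac : ∀ y, ∫⁻ γ in C, (Pi.single y 1 : Zd d → ℝ≥0∞) (walk (s + t) γ) ∂Q
      = ∫⁻ γ in C, walkSemigroup Λ ω t (Pi.single y 1) (walk s γ) ∂Q := by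
    intro y
    have hAm : MeasurableSet {γ : PathSpace d | walk (s + t) γ = y} :=
      measurable_walk (s + t) (measurableSet_singleton y)
    have hind : Integrable (Set.indicator {γ : PathSpace d | walk (s + t) γ = y}
        (fun _ => (1 : ℝ))) Q := (integrable_const 1).indicator hAm
    have h1 := setIntegral_condExp ((walkFiltration d).le s) hind hC
    have hpi : Integrable (fun γ => p t (walk s γ) y) Q := integrable_condExp.congr (hm s t y)
    rw [setIntegral_congr_ae hC' ((hm s t y).mono fun γ hγ _ => hγ)] at h1
    have h2 := congrArg ENNReal.ofReal h1
    rw [ofReal_integral_eq_lintegral_ofReal hpi.integrableOn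
        (Eventually.of_forall fun γ => hp.nonneg t t.coe_nonneg _ _),
      ofReal_integral_eq_lintegral_ofReal hind.integrableOn
        (Eventually.of_forall fun γ => indicator_nonneg (fun _ _ => zero_le_one) _)] at h2
    calc ∫⁻ γ in C, (Pi.single y 1 : Zd d → ℝ≥0∞) (walk (s + t) γ) ∂Q
        = ∫⁻ γ in C, ENNReal.ofReal (Set.indicator {γ : PathSpace d | walk (s + t) γ = y}
            (fun _ => (1 : ℝ)) γ) ∂Q := by
          refine lintegral_congr fun γ => ?_
          by_cases hγ : walk (s + t) γ = y
          · simp [hγ]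
          · simp [hγ]
      _ = _ := by
          rw [← h2]
          exact lintegral_congr fun γ => hp.ofReal_eq_walkSemigroup hΛ h t.coe_nonneg _ _
  have hmeas : ∀ (g : Zd d → ℝ≥0∞) (r : ℝ≥0), Measurable fun γ => g (walk r γ) :=
    fun g r => (measurable_of_countable g).comp (measurable_walk r)
  calc ∫⁻ γ in C, f (walk (s + t) γ) ∂Q
      = ∫⁻ γ in C, ∑' y, f y * (Pi.single y 1 : Zd d → ℝ≥0∞) (walk (s + t) γ) ∂Q := by
        simp only [tsum_mul_single]
    _ = ∑' y, f y * ∫⁻ γ in C, (Pi.single y 1 : Zd d → ℝ≥0∞) (walk (s + t) γ) ∂Q := by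
        rw [lintegral_tsum fun y => ((hmeas _ _).const_mul _).aemeasurable]
        simp only [lintegral_const_mul _ (hmeas _ _)]
    _ = ∫⁻ γ in C, ∑' y, f y * walkSemigroup Λ ω t (Pi.single y 1) (walk s γ) ∂Q := by
        simp only [hdirac]
        rw [lintegral_tsum fun y => ((hmeas (fun z => walkSemigroup Λ ω t (Pi.single y 1) z)
          s).const_mul _).aemeasurable]
        exact tsum_congr fun y => (lintegral_const_mul _
          (hmeas (fun z => walkSemigroup Λ ω t (Pi.single y 1) z) s)).symm
    _ = _ := by simp only [← walkSemigroup_eq_tsum]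

theorem IsWalkLaw.lintegral_walk {x : Zd d} {Q : Measure (PathSpace d)}
    (hQ : IsWalkLaw ω x Q) (hΛ : 0 ≤ Λ) (h : RateBound Λ ω) (t : ℝ≥0) (f : Zd d → ℝ≥0∞) :
    ∫⁻ γ, f (walk t γ) ∂Q = walkSemigroup Λ ω t f x := by
  have := hQ.isProbabilityMeasure
  have h1 := hQ.setLIntegral_walk_add hΛ h 0 t MeasurableSet.univ f
  rw [zero_add, Measure.restrict_univ] at h1
  rw [h1, lintegral_congr_ae (g := fun _ => walkSemigroup Λ ω t f x)
    (hQ.start.mono fun γ hγ => by simp only [hγ])]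
  simp

theorem setLIntegral_Ioc_add_left (g : ℝ → ℝ≥0∞) (s u : ℝ) :
    ∫⁻ r in Ioc s (s + u), g r = ∫⁻ r in Ioc 0 u, g (s + r) := by
  have h := (measurePreserving_add_left (volume : Measure ℝ) s).setLIntegral_comp_preimage_emb
    (measurableEmbedding_addLeft s) g (Ioc s (s + u))
  rw [← h]
  congr 2
  ext r
  simp

/-- The Markov property at time `s` rewrites each later expectation through the semigroup started at
`X_s`, and the integrated Kolmogorov equation is then applied pathwise. Both sides may be infinite.
-/
theorem IsWalkLaw.dynkin {x : Zd d} {Q : Measure (PathSpace d)}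
    (hQ : IsWalkLaw ω x Q) (hΛ : 0 ≤ Λ) (h : RateBound Λ ω) {s t : ℝ≥0} (hst : s ≤ t)
    {C : Set (PathSpace d)} (hC : MeasurableSet[walkFiltration d s] C) (f : Zd d → ℝ≥0∞) :
    ∫⁻ γ in C, f (walk t γ) ∂Q
        + ENNReal.ofReal Λ * ∫⁻ r in Ioc (s : ℝ) t, ∫⁻ γ in C, f (walk r.toNNReal γ) ∂Q
      = ∫⁻ γ in C, f (walk s γ) ∂Q
        + ∫⁻ r in Ioc (s : ℝ) t, ∫⁻ γ in C, jumpOp Λ ω f (walk r.toNNReal γ) ∂Q := by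
  have := hQ.isProbabilityMeasure
  obtain ⟨u, rfl⟩ := exists_add_of_le hst
  have hmeas : ∀ g : Zd d → ℝ≥0∞,
      Measurable fun q : ℝ × PathSpace d => walkSemigroup Λ ω q.1 g (walk s q.2) := by
    intro g
    have h1 : Measurable fun q : ℝ × Zd d => walkSemigroup Λ ω q.1 g q.2 :=
      measurable_from_prod_countable_left fun x => measurable_walkSemigroup g x
    exact h1.comp (measurable_fst.prodMk ((measurable_walk s).comp measurable_snd))
  have hint : ∀ g : Zd d → ℝ≥0∞,
      ∫⁻ r in Ioc (s : ℝ) (s + u : ℝ≥0), ∫⁻ γ in C, g (walk r.toNNReal γ) ∂Q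
        = ∫⁻ γ in C, (∫⁻ r in Ioc (0 : ℝ) u, walkSemigroup Λ ω r g (walk s γ)) ∂Q := by
    intro g
    rw [NNReal.coe_add, setLIntegral_Ioc_add_left, lintegral_lintegral_swap
      (f := fun γ r => walkSemigroup Λ ω r g (walk s γ))
      ((hmeas g).comp measurable_swap).aemeasurable]
    refine setLIntegral_congr_fun measurableSet_Ioc fun r hr => ?_
    have h1 : ((s : ℝ) + r).toNNReal = s + r.toNNReal := by
      rw [Real.toNNReal_add s.coe_nonneg hr.1.le, Real.toNNReal_coe]
    simp only [h1]
    rw [hQ.setLIntegral_walk_add hΛ h s r.toNNReal hC g, Real.coe_toNNReal r hr.1.le]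
  have hm : ∀ g : Zd d → ℝ≥0∞, Measurable fun γ : PathSpace d => g (walk s γ) :=
    fun g => (measurable_of_countable g).comp (measurable_walk s)
  rw [hint, hint, hQ.setLIntegral_walk_add hΛ h s u hC,
    ← lintegral_const_mul' _ _ ENNReal.ofReal_ne_top,
    ← lintegral_add_left (hm fun y => walkSemigroup Λ ω u f y), ← lintegral_add_left (hm f)]
  exact lintegral_congr fun γ => walkSemigroup_add_lintegral hΛ u.coe_nonneg f (walk s γ)

/-! ### Dynkin's formula under the annealed measure -/

theorem setLIntegral_compProd_section {α β : Type*} {mα : MeasurableSpace α}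
    {mβ : MeasurableSpace β} {P : Measure α} [SFinite P] {κ : Kernel α β} [IsSFiniteKernel κ]
    {G : Set (α × β)} (hG : MeasurableSet G) {H : α × β → ℝ≥0∞} (hH : Measurable H) :
    ∫⁻ η in G, H η ∂(P ⊗ₘ κ) = ∫⁻ ω, ∫⁻ γ in Prod.mk ω ⁻¹' G, H (ω, γ) ∂(κ ω) ∂P := by
  rw [← lintegral_indicator hG, Measure.lintegral_compProd (hH.indicator hG)]
  refine lintegral_congr fun ω => ?_
  rw [← lintegral_indicator (measurable_prodMk_left hG)]
  rfl

theorem measurable_jumpOp {F : Zd d → Env d → ℝ≥0∞} (hF : ∀ x, Measurable (F x)) (x : Zd d) :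
    Measurable fun ω => jumpOp Λ ω (fun y => F y ω) x := by
  unfold jumpOp
  have hc : ∀ z, Measurable fun ω : Env d => conductance ω x (x + z) :=
    fun z => measurable_conductance x (x + z)
  exact (Finset.measurable_fun_sum _ fun z _ => (hc z).ennreal_ofReal.mul (hF _)).add
    ((measurable_const.sub (Finset.measurable_fun_sum _ fun z _ => hc z)).ennreal_ofReal.mul (hF x))

/-- Once `ω` is frozen, an event of `annealedFiltration d s` becomes an event of `walkFiltration d
s`, so the quenched formula applies for almost every `ω` and is integrated by Tonelli. -/
theorem annealed_dynkin {P : Measure (Env d)} [SFinite P] {κ : Kernel (Env d) (PathSpace d)}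
    [IsMarkovKernel κ] (hκ : ∀ᵐ ω ∂P, IsWalkLaw ω 0 (κ ω)) (hΛ : 0 ≤ Λ)
    (hP : ∀ᵐ ω ∂P, RateBound Λ ω) {s t : ℝ≥0} (hst : s ≤ t)
    {G : Set (Env d × PathSpace d)} (hG : MeasurableSet[annealedFiltration d s] G)
    {F : Zd d → Env d → ℝ≥0∞} (hF : ∀ x, Measurable (F x)) :
    ∫⁻ η in G, F (walk t η.2) η.1 ∂(P ⊗ₘ κ) + ENNReal.ofReal Λ *
        ∫⁻ r in Ioc (s : ℝ) t, ∫⁻ η in G, F (walk r.toNNReal η.2) η.1 ∂(P ⊗ₘ κ)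
      = ∫⁻ η in G, F (walk s η.2) η.1 ∂(P ⊗ₘ κ) + ∫⁻ r in Ioc (s : ℝ) t,
        ∫⁻ η in G, jumpOp Λ η.1 (fun y => F y η.1) (walk r.toNNReal η.2) ∂(P ⊗ₘ κ) := by
  have hG' : MeasurableSet G := (annealedFiltration d).le s _ hG
  have hm : ∀ {F : Zd d → Env d → ℝ≥0∞}, (∀ x, Measurable (F x)) → ∀ r : ℝ≥0,
      Measurable fun η : Env d × PathSpace d => F (walk r η.2) η.1 :=
    fun hF r => (measurable_comp_walk hF r).mono ((annealedFiltration d).le r) le_rfl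
  have hsec : ∀ ω, MeasurableSet[walkFiltration d s] (Prod.mk ω ⁻¹' G) := by
    intro ω
    let _ : MeasurableSpace (PathSpace d) := walkFiltration d s
    exact measurable_prodMk_left hG
  have hint : ∀ {F : Zd d → Env d → ℝ≥0∞}, (∀ x, Measurable (F x)) →
      ∫⁻ r in Ioc (s : ℝ) t, ∫⁻ η in G, F (walk r.toNNReal η.2) η.1 ∂(P ⊗ₘ κ)
        = ∫⁻ ω, (∫⁻ r in Ioc (s : ℝ) t, ∫⁻ γ in Prod.mk ω ⁻¹' G,
          F (walk r.toNNReal γ) ω ∂(κ ω)) ∂P := by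
    intro F hF
    rw [lintegral_lintegral_swap (measurable_comp_walk_toNNReal hF).aemeasurable,
      setLIntegral_compProd_section hG']
    · refine lintegral_congr fun ω => ?_
      rw [lintegral_lintegral_swap]
      exact ((measurable_comp_walk_toNNReal hF).comp (measurable_snd.prodMk
        (measurable_const.prodMk measurable_fst))).aemeasurable
    · exact Measurable.lintegral_prod_right
        ((measurable_comp_walk_toNNReal hF).comp measurable_swap)
  have hm2 : Measurable fun ω => ∫⁻ γ in Prod.mk ω ⁻¹' G, F (walk t γ) ω ∂(κ ω) := by
    have : Measurable fun ω => ∫⁻ γ, G.indicator (fun η => F (walk t η.2) η.1) (ω, γ) ∂(κ ω) :=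
      ((hm hF t).indicator hG').lintegral_kernel_prod_right'
    convert this using 2 with ω
    rw [← lintegral_indicator (measurable_prodMk_left hG')]
    rfl
  have hm3 : Measurable fun ω => ∫⁻ γ in Prod.mk ω ⁻¹' G, F (walk s γ) ω ∂(κ ω) := by
    have : Measurable fun ω => ∫⁻ γ, G.indicator (fun η => F (walk s η.2) η.1) (ω, γ) ∂(κ ω) :=
      ((hm hF s).indicator hG').lintegral_kernel_prod_right'
    convert this using 2 with ω
    rw [← lintegral_indicator (measurable_prodMk_left hG')]
    rfl
  rw [hint hF, hint (F := fun x ω => jumpOp Λ ω (fun y => F y ω) x) fun x => measurable_jumpOp hF x,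
    setLIntegral_compProd_section hG' (hm hF t), setLIntegral_compProd_section hG' (hm hF s),
    ← lintegral_const_mul' _ _ ENNReal.ofReal_ne_top, ← lintegral_add_left hm2,
    ← lintegral_add_left hm3]
  refine lintegral_congr_ae ?_
  filter_upwards [hκ, hP] with ω hω hω'
  exact hω.dynkin hΛ hω' hst (hsec ω) fun y => F y ω

theorem annealed_lintegral_walk {P : Measure (Env d)} [SFinite P]
    {κ : Kernel (Env d) (PathSpace d)}
    [IsMarkovKernel κ] (hκ : ∀ᵐ ω ∂P, IsWalkLaw ω 0 (κ ω)) (hΛ : 0 ≤ Λ)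
    (hP : ∀ᵐ ω ∂P, RateBound Λ ω) (t : ℝ≥0) {F : Zd d → Env d → ℝ≥0∞}
    (hF : ∀ x, Measurable (F x)) :
    ∫⁻ η, F (walk t η.2) η.1 ∂(P ⊗ₘ κ) = ∫⁻ ω, walkSemigroup Λ ω t (fun y => F y ω) 0 ∂P := by
  rw [Measure.lintegral_compProd ((measurable_comp_walk hF t).mono
    ((annealedFiltration d).le t) le_rfl)]
  refine lintegral_congr_ae ?_
  filter_upwards [hκ, hP] with ω hω hω'
  exact hω.lintegral_walk hΛ hω' t fun y => F y ω

/-! ### Stationarity of the environment viewed by the particle -/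

theorem shift_add (x y : Zd d) (ω : Env d) : shift x (shift y ω) = shift (y + x) ω := by
  funext e
  simp only [shift, shiftBond, Sym2.map_map]
  congr 3
  funext z
  simp [add_assoc]

theorem shift_zero (ω : Env d) : shift 0 ω = ω := by
  funext e
  simp only [shift, shiftBond, zero_add]
  congr 1
  exact Subtype.ext (congrFun Sym2.map_id' e.1)

theorem measurable_shift (x : Zd d) : Measurable (shift (d := d) x) :=
  measurable_pi_lambda _ fun _ => measurable_pi_apply _

theorem shiftBond_injective (x : Zd d) : Function.Injective (shiftBond x) := fun _ _ h =>
  Subtype.ext (Sym2.map.injective (add_right_injective x) (congrArg Subtype.val h))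

/-- By independence `P` is the product of its marginals. Relabelling along the injective `shiftBond
x` keeps independence, and identical distribution gives the same marginals. -/
theorem IsEnvLaw.measurePreserving_shift {P : Measure (Env d)} (hP : IsEnvLaw P) (x : Zd d) :
    MeasurePreserving (shift x) P P := by
  have := hP.isProbabilityMeasure
  refine ⟨measurable_shift x, ?_⟩
  have h1 := hP.indep.map_fun_eq_infinitePi_map fun e => measurable_pi_apply e
  have h2 := (hP.indep.precomp (shiftBond_injective x)).map_fun_eq_infinitePi_map
    fun e => measurable_pi_apply _
  have h3 : P.map (fun (ω : Env d) e => ω e) = P := Measure.map_id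
  rw [h3] at h1
  conv_rhs => rw [h1]
  refine h2.trans ?_
  congr 1
  funext e
  exact (hP.identDistrib _ _).map_eq

/-- Translation covariance: on functions of the form `y ↦ h(θ_y ω)` the walk operator at `x` is an
operator on environments evaluated at `θ_x ω`. Its iterates therefore describe the environment seen
from the particle. -/
theorem jumpOp_comp_shift (h : Env d → ℝ≥0∞) (ω : Env d) (x : Zd d) :
    jumpOp Λ ω (fun y => h (shift y ω)) x
      = jumpOp Λ (shift x ω) (fun y => h (shift y (shift x ω))) 0 := by
  simp only [jumpOp, zero_add, conductance_shift, shift_add, add_zero]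

theorem iterate_jumpOp_comp_shift (h : Env d → ℝ≥0∞) (ω : Env d) (n : ℕ) (x : Zd d) :
    (jumpOp Λ ω)^[n] (fun y => h (shift y ω)) x
      = (fun (g : Env d → ℝ≥0∞) ω => jumpOp Λ ω (fun y => g (shift y ω)) 0)^[n] h (shift x ω) := by
  induction n generalizing x with
  | zero => rfl
  | succ n ih =>
    rw [Function.iterate_succ_apply', Function.iterate_succ_apply', funext ih, jumpOp_comp_shift]

theorem conductance_symm (ω : Env d) (x y : Zd d) : conductance ω x y = conductance ω y x := by
  unfold conductance
  by_cases h : (latticeGraph d).Adj x y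
  · rw [dif_pos h, dif_pos h.symm]
    congr 2
    exact Subtype.ext Sym2.eq_swap
  · rw [dif_neg h, dif_neg fun h' => h h'.symm]

theorem sum_unitVectors_neg {E : Type*} [AddCommMonoid E] (f : Zd d → E) :
    ∑ z ∈ unitVectors d, f (-z) = ∑ z ∈ unitVectors d, f z := by
  refine Finset.sum_nbij' (fun z => -z) (fun z => -z) ?_ ?_ ?_ ?_ ?_ <;>
    simp [mem_unitVectors]

/-- Reversibility: shift invariance and the symmetry of the conductances exchange the jump `z` with
the jump `-z`; after summation the gain and loss terms add up to the constant rate `Λ`. -/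
theorem lintegral_jumpOp_comp_shift {P : Measure (Env d)} (hP : IsEnvLaw P)
    (hR : ∀ᵐ ω ∂P, RateBound Λ ω) {h : Env d → ℝ≥0∞} (hh : Measurable h) :
    ∫⁻ ω, jumpOp Λ ω (fun y => h (shift y ω)) 0 ∂P = ENNReal.ofReal Λ * ∫⁻ ω, h ω ∂P := by
  have hc : ∀ z, Measurable fun ω : Env d => ENNReal.ofReal (conductance ω 0 z) :=
    fun z => (measurable_conductance 0 z).ennreal_ofReal
  have hch : ∀ z, Measurable fun ω : Env d => ENNReal.ofReal (conductance ω 0 z) * h ω :=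
    fun z => (hc z).mul hh
  have hcs : ∀ z, Measurable fun ω : Env d =>
      ENNReal.ofReal (conductance ω 0 z) * h (shift z ω) :=
    fun z => (hc z).mul (hh.comp (measurable_shift z))
  have hterm : ∀ z, ∫⁻ ω, ENNReal.ofReal (conductance ω 0 z) * h (shift z ω) ∂P
      = ∫⁻ ω, ENNReal.ofReal (conductance ω 0 (-z)) * h ω ∂P := by
    intro z
    -- Invariance is used on `ω ↦ ω_{0,-z} h(ω)`: composing with `θ_z` turns the conductance into
    -- `ω_{z,0} = ω_{0,z}`.
    rw [← (hP.measurePreserving_shift z).lintegral_comp (hch (-z))]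
    refine lintegral_congr fun ω => ?_
    simp only [conductance_shift, add_zero, add_neg_cancel]
    rw [conductance_symm]
  have hconst : ∀ᵐ ω ∂P, ∑ z ∈ unitVectors d, ENNReal.ofReal (conductance ω 0 z) * h ω
      + ENNReal.ofReal (Λ - ∑ z ∈ unitVectors d, conductance ω 0 z) * h ω
      = ENNReal.ofReal Λ * h ω := by
    filter_upwards [hR] with ω hω
    have := congrFun (jumpOp_const hω (h ω)) 0
    simpa only [jumpOp, zero_add] using this
  rw [← lintegral_const_mul _ hh, ← lintegral_congr_ae hconst]
  simp only [jumpOp, zero_add, shift_zero]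
  rw [lintegral_add_left (Finset.measurable_fun_sum _ fun z _ => hcs z),
    lintegral_add_left (Finset.measurable_fun_sum _ fun z _ => hch z),
    lintegral_finsetSum _ fun z _ => hcs z, lintegral_finsetSum _ fun z _ => hch z]
  simp only [hterm]
  rw [sum_unitVectors_neg fun z => ∫⁻ ω, ENNReal.ofReal (conductance ω 0 z) * h ω ∂P]

/-- The law of the environment is invariant for the environment viewed by the particle. -/
theorem annealed_lintegral_environment {P : Measure (Env d)} (hP : IsEnvLaw P)
    {κ : Kernel (Env d) (PathSpace d)} [IsMarkovKernel κ]
    (hκ : ∀ᵐ ω ∂P, IsWalkLaw ω 0 (κ ω)) (hΛ : 0 ≤ Λ) (hR : ∀ᵐ ω ∂P, RateBound Λ ω) (t : ℝ≥0)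
    {h : Env d → ℝ≥0∞} (hh : Measurable h) :
    ∫⁻ η, h (envProcess t η) ∂(P ⊗ₘ κ) = ∫⁻ ω, h ω ∂P := by
  have := hP.isProbabilityMeasure
  have hmn : ∀ n, Measurable
      ((fun (g : Env d → ℝ≥0∞) ω => jumpOp Λ ω (fun y => g (shift y ω)) 0)^[n] h) ∧
      ∫⁻ ω, (fun (g : Env d → ℝ≥0∞) ω => jumpOp Λ ω (fun y => g (shift y ω)) 0)^[n] h ω ∂P
        = ENNReal.ofReal Λ ^ n * ∫⁻ ω, h ω ∂P := by
    intro n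
    induction n with
    | zero => exact ⟨hh, by simp⟩
    | succ n ih =>
      simp only [Function.iterate_succ_apply']
      refine ⟨measurable_jumpOp (fun y => ih.1.comp (measurable_shift y)) 0, ?_⟩
      rw [lintegral_jumpOp_comp_shift hP hR ih.1, ih.2, pow_succ', mul_assoc]
  have h1 := annealed_lintegral_walk hκ hΛ hR t (F := fun x ω => h (shift x ω))
    fun x => hh.comp (measurable_shift x)
  unfold envProcess
  rw [h1]
  unfold walkSemigroup
  simp only [iterate_jumpOp_comp_shift, shift_zero]
  rw [lintegral_tsum fun n => ((hmn n).1.const_mul _).aemeasurable]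
  simp only [lintegral_const_mul _ (hmn _).1, (hmn _).2, ← mul_assoc]
  -- The `n`-th iterate has integral `Λ^n ∫ h`, so the series is the Poisson total mass times `∫ h`.
  rw [ENNReal.tsum_mul_right, tsum_poissonWeight_mul_pow hΛ t.coe_nonneg]
  simp

end RandomConductance

namespace RandomConductance

/-! ### Martingales and square-integrable processes -/

section Martingale

variable {S : Type*} {mS : MeasurableSpace S} {Q : Measure S} {ℱ : Filtration ℝ≥0 mS}

theorem martingale_of_setIntegral_eq [IsFiniteMeasure Q] {f : ℝ≥0 → S → ℝ}
    (hf : StronglyAdapted ℱ f) (hint : ∀ t, Integrable (f t) Q)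
    (h : ∀ s t, s ≤ t → ∀ G, MeasurableSet[ℱ s] G → ∫ η in G, f t η ∂Q = ∫ η in G, f s η ∂Q) :
    Martingale f ℱ Q := by
  refine ⟨hf, fun s t hst => (ae_eq_condExp_of_forall_setIntegral_eq (ℱ.le s) (hint t)
    (fun _ _ _ => (hint s).integrableOn) (fun G hG _ => (h s t hst G hG).symm)
    (hf s).aestronglyMeasurable).symm⟩

theorem memLp_two_of_lintegral_sq {f : S → ℝ} (hf : Measurable f)
    (h : ∫⁻ η, ENNReal.ofReal (f η ^ 2) ∂Q ≠ ∞) : MemLp f 2 Q := by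
  refine (memLp_two_iff_integrable_sq hf.aestronglyMeasurable).2
    ⟨(hf.pow_const 2).aestronglyMeasurable, ?_⟩
  rw [hasFiniteIntegral_iff_ofReal (Eventually.of_forall fun η => sq_nonneg (f η))]
  exact lt_top_iff_ne_top.2 h

theorem setIntegral_martingale_mul_eq [IsFiniteMeasure Q]
    {M : ℝ≥0 → S → ℝ} (hM : Martingale M ℱ Q)
    (hM2 : ∀ t, MemLp (M t) 2 Q) {s t : ℝ≥0} (hst : s ≤ t) {Z : S → ℝ}
    (hZ : StronglyMeasurable[ℱ s] Z) (hZ2 : MemLp Z 2 Q) {G : Set S} (hG : MeasurableSet[ℱ s] G) :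
    ∫ η in G, M t η * Z η ∂Q = ∫ η in G, M s η * Z η ∂Q := by
  have hi : Integrable (M t * Z) Q := (hM2 t).integrable_mul hZ2
  have h1 := condExp_mul_of_stronglyMeasurable_right hZ hi (hM.integrable t)
  have h2 : ∀ᵐ η ∂Q, η ∈ G → (Q[M t * Z | ℱ s]) η = M s η * Z η := by
    filter_upwards [h1, hM.2 s t hst] with η h1 h2 _
    rw [h1, Pi.mul_apply, h2]
  rw [← setIntegral_congr_ae (ℱ.le s _ hG) h2, setIntegral_condExp (ℱ.le s) hi hG]
  rfl

/-- Cauchy–Schwarz in time, obtained from the nonnegativity of the integrated squared deviation of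
`f` from its mean `B / t`. -/
theorem sq_intervalIntegral_le {f : ℝ → ℝ} {t : ℝ} (ht : 0 ≤ t)
    (hf : IntervalIntegrable f volume 0 t)
    (hf2 : IntervalIntegrable (fun r => f r ^ 2) volume 0 t) :
    (∫ r in (0 : ℝ)..t, f r) ^ 2 ≤ t * ∫ r in (0 : ℝ)..t, f r ^ 2 := by
  rcases ht.eq_or_lt with rfl | ht
  · simp
  set B := ∫ r in (0 : ℝ)..t, f r
  have h : ∫ r in (0 : ℝ)..t, (f r - B / t) ^ 2
      = (∫ r in (0 : ℝ)..t, f r ^ 2) - 2 * (B / t) * B + t * (B / t) ^ 2 := by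
    have : ∀ r, (f r - B / t) ^ 2 = f r ^ 2 - 2 * (B / t) * f r + (B / t) ^ 2 := fun r => by ring
    simp only [this]
    rw [intervalIntegral.integral_add (hf2.sub (hf.const_mul _)) (by simp),
      intervalIntegral.integral_sub hf2 (hf.const_mul _), intervalIntegral.integral_const_mul]
    simp [B]
  have h0 : 0 ≤ ∫ r in (0 : ℝ)..t, (f r - B / t) ^ 2 :=
    intervalIntegral.integral_nonneg ht.le fun _ _ => sq_nonneg _
  rw [h] at h0
  have h1 : t * ((∫ r in (0 : ℝ)..t, f r ^ 2) - 2 * (B / t) * B + t * (B / t) ^ 2)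
      = t * (∫ r in (0 : ℝ)..t, f r ^ 2) - B ^ 2 := by
    field_simp
    ring
  nlinarith [mul_nonneg ht.le h0]

theorem lintegral_sq_intervalIntegral_le [SFinite Q] {b : ℝ≥0 → S → ℝ}
    (hb : Measurable fun q : ℝ × S => b q.1.toNNReal q.2)
    (hbi : ∀ η a c, IntervalIntegrable (fun r => b r.toNNReal η) volume a c)
    (hbi2 : ∀ η a c, IntervalIntegrable (fun r => b r.toNNReal η ^ 2) volume a c)
    {T t : ℝ≥0} (htT : t ≤ T) {C : ℝ≥0}
    (hC : ∀ t ≤ T, ∫⁻ η, ENNReal.ofReal (b t η ^ 2) ∂Q ≤ C) :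
    ∫⁻ η, ENNReal.ofReal ((∫ r in (0 : ℝ)..t, b r.toNNReal η) ^ 2) ∂Q ≤ (T * T * C : ℝ≥0) := by
  calc ∫⁻ η, ENNReal.ofReal ((∫ r in (0 : ℝ)..t, b r.toNNReal η) ^ 2) ∂Q
      ≤ ∫⁻ η, (t * ∫⁻ r in Ioc (0 : ℝ) t, ENNReal.ofReal (b r.toNNReal η ^ 2)) ∂Q := by
        refine lintegral_mono fun η => ?_
        refine (ENNReal.ofReal_le_ofReal
          (sq_intervalIntegral_le t.coe_nonneg (hbi η _ _) (hbi2 η _ _))).trans_eq ?_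
        rw [ENNReal.ofReal_mul t.coe_nonneg, ENNReal.ofReal_coe_nnreal,
          intervalIntegral.integral_of_le t.coe_nonneg, ofReal_integral_eq_lintegral_ofReal]
        · exact (intervalIntegrable_iff_integrableOn_Ioc_of_le t.coe_nonneg).1 (hbi2 η _ _)
        · exact Eventually.of_forall fun r => sq_nonneg _
    _ = t * ∫⁻ r in Ioc (0 : ℝ) t, (∫⁻ η, ENNReal.ofReal (b r.toNNReal η ^ 2) ∂Q) := by
        rw [lintegral_const_mul' _ _ ENNReal.coe_ne_top, lintegral_lintegral_swap
          (f := fun η (r : ℝ) => ENNReal.ofReal (b r.toNNReal η ^ 2))]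
        exact ((hb.comp measurable_swap).pow_const 2).ennreal_ofReal.aemeasurable
    _ ≤ t * ∫⁻ r in Ioc (0 : ℝ) t, (C : ℝ≥0∞) := by
        gcongr t * ?_
        exact setLIntegral_mono' measurableSet_Ioc fun r hr =>
          hC _ ((Real.toNNReal_le_iff_le_coe.2 hr.2).trans htT)
    _ ≤ (T * T * C : ℝ≥0) := by
        rw [setLIntegral_const, Real.volume_Ioc, sub_zero, ENNReal.ofReal_coe_nnreal]
        exact_mod_cast (by rw [mul_comm C, ← mul_assoc]; gcongr)

theorem integrable_prod_of_lintegral_le [SFinite Q] {E : Type*} [NormedAddCommGroup E]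
    [MeasurableSpace E] [OpensMeasurableSpace E] [SecondCountableTopology E]
    {H : ℝ≥0 → S → E} (hH : Measurable fun q : ℝ × S => H q.1.toNNReal q.2)
    {s t : ℝ≥0} {C : ℝ≥0} (hC : ∀ r ≤ t, ∫⁻ η, ‖H r η‖ₑ ∂Q ≤ C) :
    Integrable (fun q : ℝ × S => H q.1.toNNReal q.2)
      (((volume : Measure ℝ).restrict (Ioc (s : ℝ) t)).prod Q) := by
  refine ⟨hH.aestronglyMeasurable, ?_⟩
  rw [HasFiniteIntegral, lintegral_prod _ hH.enorm.aemeasurable]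
  calc ∫⁻ r in Ioc (s : ℝ) t, (∫⁻ η, ‖H r.toNNReal η‖ₑ ∂Q)
      ≤ ∫⁻ r in Ioc (s : ℝ) t, (C : ℝ≥0∞) :=
        setLIntegral_mono' measurableSet_Ioc fun r hr => hC _ (Real.toNNReal_le_iff_le_coe.2 hr.2)
    _ < ∞ := by
        rw [setLIntegral_const, Real.volume_Ioc]
        exact ENNReal.mul_lt_top ENNReal.coe_lt_top ENNReal.ofReal_lt_top

/-- If `M` is a square-integrable martingale and `B = ∫ b`, then `M B - ∫ M b` is a martingale. -/
theorem setIntegral_mul_sub_integral [IsFiniteMeasure Q] {M b : ℝ≥0 → S → ℝ}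
    (hM : Martingale M ℱ Q) (hMm : Measurable fun q : ℝ × S => M q.1.toNNReal q.2)
    (hbm : Measurable fun q : ℝ × S => b q.1.toNNReal q.2)
    (hb : ∀ t, Measurable[ℱ t] (b t))
    (hB : ∀ t : ℝ≥0, Measurable[ℱ t] fun η => ∫ r in (0 : ℝ)..t, b r.toNNReal η)
    (hM2 : ∀ T : ℝ≥0, ∃ C : ℝ≥0, ∀ t ≤ T, ∫⁻ η, ENNReal.ofReal (M t η ^ 2) ∂Q ≤ C)
    (hb2 : ∀ T : ℝ≥0, ∃ C : ℝ≥0, ∀ t ≤ T, ∫⁻ η, ENNReal.ofReal (b t η ^ 2) ∂Q ≤ C)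
    (hbi : ∀ η a c, IntervalIntegrable (fun r => b r.toNNReal η) volume a c)
    (hbi2 : ∀ η a c, IntervalIntegrable (fun r => b r.toNNReal η ^ 2) volume a c)
    (hMbi : ∀ η a c, IntervalIntegrable (fun r => M r.toNNReal η * b r.toNNReal η) volume a c) :
    (∀ t : ℝ≥0, Integrable (fun η => M t η * (∫ r in (0 : ℝ)..t, b r.toNNReal η)
      - ∫ r in (0 : ℝ)..t, M r.toNNReal η * b r.toNNReal η) Q) ∧
    ∀ s t : ℝ≥0, s ≤ t → ∀ G, MeasurableSet[ℱ s] G →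
    ∫ η in G, (M t η * (∫ r in (0 : ℝ)..t, b r.toNNReal η)
        - ∫ r in (0 : ℝ)..t, M r.toNNReal η * b r.toNNReal η) ∂Q
      = ∫ η in G, (M s η * (∫ r in (0 : ℝ)..s, b r.toNNReal η)
        - ∫ r in (0 : ℝ)..s, M r.toNNReal η * b r.toNNReal η) ∂Q := by
  have hMm' : ∀ t, Measurable (M t) := fun t => ((hM.1 t).mono (ℱ.le t)).measurable
  have hbm' : ∀ t, Measurable (b t) := fun t => (hb t).mono (ℱ.le t) le_rfl
  have hML : ∀ t, MemLp (M t) 2 Q := fun t => by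
    obtain ⟨C, hC⟩ := hM2 t
    exact memLp_two_of_lintegral_sq (hMm' t) (ne_top_of_le_ne_top ENNReal.coe_ne_top (hC t le_rfl))
  have hbL : ∀ t, MemLp (b t) 2 Q := fun t => by
    obtain ⟨C, hC⟩ := hb2 t
    exact memLp_two_of_lintegral_sq (hbm' t) (ne_top_of_le_ne_top ENNReal.coe_ne_top (hC t le_rfl))
  have hBL : ∀ t : ℝ≥0, MemLp (fun η => ∫ r in (0 : ℝ)..t, b r.toNNReal η) 2 Q := fun t => by
    obtain ⟨C, hC⟩ := hb2 t
    exact memLp_two_of_lintegral_sq ((hB t).mono (ℱ.le t) le_rfl)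
      (ne_top_of_le_ne_top ENNReal.coe_ne_top
        (lintegral_sq_intervalIntegral_le hbm hbi hbi2 le_rfl hC))
  have hprod : ∀ (x y : S → ℝ), (∀ C D : ℝ≥0, ∫⁻ η, ENNReal.ofReal (x η ^ 2) ∂Q ≤ C →
      ∫⁻ η, ENNReal.ofReal (y η ^ 2) ∂Q ≤ D → Measurable x →
        ∫⁻ η, ‖x η * y η‖ₑ ∂Q ≤ (C + D : ℝ≥0)) := by
    intro x y C D hC hD hx
    calc ∫⁻ η, ‖x η * y η‖ₑ ∂Q
        ≤ ∫⁻ η, (ENNReal.ofReal (x η ^ 2) + ENNReal.ofReal (y η ^ 2)) ∂Q := by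
          refine lintegral_mono fun η => ?_
          rw [← ENNReal.ofReal_add (sq_nonneg _) (sq_nonneg _), Real.enorm_eq_ofReal_abs, abs_mul]
          refine ENNReal.ofReal_le_ofReal ?_
          nlinarith [sq_nonneg (|x η| - |y η|), sq_abs (x η), sq_abs (y η), abs_nonneg (x η),
            abs_nonneg (y η), mul_nonneg (abs_nonneg (x η)) (abs_nonneg (y η))]
      _ ≤ (C + D : ℝ≥0) := by
          rw [lintegral_add_left (hx.pow_const 2).ennreal_ofReal, ENNReal.coe_add]
          exact add_le_add hC hD
  have hMb : ∀ s t : ℝ≥0, Integrable (fun q : ℝ × S => M q.1.toNNReal q.2 * b q.1.toNNReal q.2)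
      (((volume : Measure ℝ).restrict (Ioc (s : ℝ) t)).prod Q) := by
    intro s t
    obtain ⟨C, hC⟩ := hM2 t
    obtain ⟨D, hD⟩ := hb2 t
    exact integrable_prod_of_lintegral_le (H := fun r η => M r η * b r η) (hMm.mul hbm)
      (C := C + D) fun r hr => hprod _ _ _ _ (hC r hr) (hD r hr) (hMm' r)
  have hMtb : ∀ s t : ℝ≥0, Integrable (fun q : ℝ × S => M t q.2 * b q.1.toNNReal q.2)
      (((volume : Measure ℝ).restrict (Ioc (s : ℝ) t)).prod Q) := by
    intro s t
    obtain ⟨C, hC⟩ := hM2 t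
    obtain ⟨D, hD⟩ := hb2 t
    exact integrable_prod_of_lintegral_le (H := fun r η => M t η * b r η)
      (((hMm' t).comp measurable_snd).mul hbm)
      (C := C + D) fun r hr => hprod _ _ _ _ (hC t le_rfl) (hD r hr) (hMm' t)
  have hres : ∀ {f : ℝ × S → ℝ} {μ : Measure ℝ} [SFinite μ] (G : Set S), Integrable f (μ.prod Q) →
      Integrable f (μ.prod (Q.restrict G)) := by
    intro f μ _ G hf
    refine hf.mono_measure ?_
    exact Measure.prod_mono le_rfl Measure.restrict_le_self
  have hMBi : ∀ s t : ℝ≥0, Integrable (fun η => M t η * ∫ r in (0 : ℝ)..s, b r.toNNReal η) Q :=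
    fun s t => (hML t).integrable_mul (hBL s)
  have hIi : ∀ s t : ℝ≥0, s ≤ t →
      Integrable (fun η => ∫ r in (s : ℝ)..t, M r.toNNReal η * b r.toNNReal η) Q := by
    intro s t hst
    have := (hMb s t).integral_prod_right
    simpa only [intervalIntegral.integral_of_le (NNReal.coe_le_coe.2 hst)] using this
  have hIi0 : ∀ t : ℝ≥0,
      Integrable (fun η => ∫ r in (0 : ℝ)..t, M r.toNNReal η * b r.toNNReal η) Q :=
    fun t => by simpa using hIi 0 t zero_le
  refine ⟨fun t => (hMBi t t).sub (hIi0 t), fun s t hst G hG => ?_⟩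
  have h1 : ∫ η in G, M t η * (∫ r in (s : ℝ)..t, b r.toNNReal η) ∂Q
      = ∫ η in G, (∫ r in (s : ℝ)..t, M r.toNNReal η * b r.toNNReal η) ∂Q := by
    have hc : ∀ η, M t η * (∫ r in (s : ℝ)..t, b r.toNNReal η)
        = ∫ r in (s : ℝ)..t, M t η * b r.toNNReal η :=
      fun η => (intervalIntegral.integral_const_mul _ _).symm
    simp only [hc]
    simp only [intervalIntegral.integral_of_le (NNReal.coe_le_coe.2 hst)]
    -- After Fubini it suffices to compare at each fixed `r` in `(s, t]`: there `b_r` is known at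
    -- time `r`, and `G` belongs to the past of `r`, so `M_t` may be replaced by `M_r`.
    rw [← integral_integral_swap (f := fun (r : ℝ) η => M t η * b r.toNNReal η)
        (hres G (hMtb s t)),
      ← integral_integral_swap (f := fun (r : ℝ) η => M r.toNNReal η * b r.toNNReal η)
        (hres G (hMb s t))]
    refine setIntegral_congr_fun measurableSet_Ioc fun r hr => ?_
    have hsr : s ≤ r.toNNReal := NNReal.le_toNNReal_of_coe_le hr.1.le
    exact setIntegral_martingale_mul_eq hM hML (Real.toNNReal_le_iff_le_coe.2 hr.2)
      (hb _).stronglyMeasurable (hbL _) (ℱ.mono hsr _ hG)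
  have h2 := setIntegral_martingale_mul_eq hM hML hst (hB s).stronglyMeasurable (hBL s) hG
  have h3 : ∀ η, (∫ r in (0 : ℝ)..t, b r.toNNReal η)
      = (∫ r in (0 : ℝ)..s, b r.toNNReal η) + ∫ r in (s : ℝ)..t, b r.toNNReal η :=
    fun η => (intervalIntegral.integral_add_adjacent_intervals (hbi η _ _) (hbi η _ _)).symm
  have h4 : ∀ η, (∫ r in (0 : ℝ)..t, M r.toNNReal η * b r.toNNReal η)
      = (∫ r in (0 : ℝ)..s, M r.toNNReal η * b r.toNNReal η)
        + ∫ r in (s : ℝ)..t, M r.toNNReal η * b r.toNNReal η :=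
    fun η => (intervalIntegral.integral_add_adjacent_intervals (hMbi η _ _) (hMbi η _ _)).symm
  have hMst : Integrable (fun η => M t η * ∫ r in (s : ℝ)..t, b r.toNNReal η) Q := by
    refine ((hMBi t t).sub (hMBi s t)).congr (Eventually.of_forall fun η => ?_)
    simp only [Pi.sub_apply, h3 η]
    ring
  simp only [h3, h4, mul_add]
  rw [integral_sub, integral_add, integral_add, integral_sub, h1, h2]
  · ring
  all_goals first
    | exact (hMBi _ _).integrableOn
    | exact (hIi0 _).integrableOn
    | exact (hIi _ _ hst).integrableOn
    | exact hMst.integrableOn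
    | exact ((hMBi s t).add hMst).integrableOn
    | exact ((hIi0 s).add (hIi _ _ hst)).integrableOn

end Martingale

end RandomConductance

namespace RandomConductance

variable {d : ℕ} {Λ : ℝ}

/-! ### Dynkin martingales under the annealed measure -/

theorem measurable_walkGenerator {F : Zd d → Env d → ℝ} (hF : ∀ x, Measurable (F x)) (x : Zd d) :
    Measurable fun ω => walkGenerator ω (fun y => F y ω) x := by
  unfold walkGenerator
  exact Finset.measurable_fun_sum _ fun z _ =>
    (measurable_conductance x (x + z)).mul ((hF _).sub (hF _))

/-- `W` and its image by `L^ω + Λ` are integrable along the walk, locally uniformly in time. -/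
def MomentBound (P : Measure (Env d)) (κ : Kernel (Env d) (PathSpace d)) (Λ : ℝ)
    (W : Zd d → Env d → ℝ≥0∞) : Prop :=
  ∀ T : ℝ≥0, ∃ C : ℝ≥0, ∀ t ≤ T, ∫⁻ η, (W (walk t η.2) η.1
    + jumpOp Λ η.1 (fun y => W y η.1) (walk t η.2)) ∂(P ⊗ₘ κ) ≤ C

/-- The process `F(ω, X_t) - ∫_0^t L^ω F(ω, X_r) dr`. -/
noncomputable def dynkinPart (F : Zd d → Env d → ℝ) (t : ℝ≥0) (η : Env d × PathSpace d) : ℝ :=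
  F (walk t η.2) η.1
    - ∫ r in (0 : ℝ)..t, walkGenerator η.1 (fun y => F y η.1) (walk r.toNNReal η.2)

theorem measurable_comp_walk_ambient {E : Type*} [MeasurableSpace E] {F : Zd d → Env d → E}
    (hF : ∀ x, Measurable (F x)) (t : ℝ≥0) :
    Measurable fun η : Env d × PathSpace d => F (walk t η.2) η.1 :=
  (measurable_comp_walk hF t).mono ((annealedFiltration d).le t) le_rfl

theorem jumpOp_add (ω : Env d) (f g : Zd d → ℝ≥0∞) (x : Zd d) :
    jumpOp Λ ω (fun y => f y + g y) x = jumpOp Λ ω f x + jumpOp Λ ω g x := by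
  simp only [jumpOp, mul_add, Finset.sum_add_distrib]
  exact add_add_add_comm _ _ _ _

theorem MomentBound.add {P : Measure (Env d)} {κ : Kernel (Env d) (PathSpace d)}
    {V W : Zd d → Env d → ℝ≥0∞} (hV : MomentBound P κ Λ V)
    (hVm : ∀ x, Measurable (V x)) (hW : MomentBound P κ Λ W) :
    MomentBound P κ Λ fun x ω => V x ω + W x ω := by
  intro T
  obtain ⟨C, hC⟩ := hV T
  obtain ⟨D, hD⟩ := hW T
  refine ⟨C + D, fun t ht => ?_⟩
  have hm : Measurable fun η : Env d × PathSpace d =>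
      V (walk t η.2) η.1 + jumpOp Λ η.1 (fun y => V y η.1) (walk t η.2) :=
    (measurable_comp_walk_ambient hVm t).add
      (measurable_comp_walk_ambient (F := fun x ω => jumpOp Λ ω (fun y => V y ω) x)
        (fun x => measurable_jumpOp hVm x) t)
  rw [ENNReal.coe_add]
  refine (lintegral_congr fun η => ?_).trans_le
    ((lintegral_add_left hm fun η => W (walk t η.2) η.1
      + jumpOp Λ η.1 (fun y => W y η.1) (walk t η.2)).trans_le (add_le_add (hC t ht) (hD t ht)))
  rw [jumpOp_add, add_add_add_comm]

theorem MomentBound.const_mul {P : Measure (Env d)} {κ : Kernel (Env d) (PathSpace d)}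
    {W : Zd d → Env d → ℝ≥0∞} (hW : MomentBound P κ Λ W) (c : ℝ≥0) :
    MomentBound P κ Λ fun x ω => c * W x ω := by
  intro T
  obtain ⟨C, hC⟩ := hW T
  refine ⟨c * C, fun t ht => ?_⟩
  simp only [jumpOp_const_mul, ← mul_add]
  rw [lintegral_const_mul' _ _ ENNReal.coe_ne_top, ENNReal.coe_mul]
  gcongr
  exact hC t ht

section

variable {P : Measure (Env d)} {κ : Kernel (Env d) (PathSpace d)} [IsMarkovKernel κ]

theorem ae_fst_of_ae [SFinite P] {p : Env d → Prop} (h : ∀ᵐ ω ∂P, p ω) :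
    ∀ᵐ η ∂(P ⊗ₘ κ), p η.1 := by
  have h1 : (P ⊗ₘ κ).map Prod.fst = P := Measure.fst_compProd P κ
  exact ae_of_ae_map measurable_fst.aemeasurable (by rw [h1]; exact h)

/-- The moment bound makes all four terms of `annealed_dynkin` finite. They can then be read as real
integrals, and the contribution of `Λ F` cancels, leaving the generator alone. -/
theorem dynkin_of_nonneg [IsProbabilityMeasure P] (hκ : ∀ᵐ ω ∂P, IsWalkLaw ω 0 (κ ω))
    (hΛ : 0 ≤ Λ) (hR : ∀ᵐ ω ∂P, RateBound Λ ω) {W : Zd d → Env d → ℝ≥0∞}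
    (hW : MomentBound P κ Λ W) {F : Zd d → Env d → ℝ} (hF : ∀ x, Measurable (F x))
    (hF0 : ∀ x ω, 0 ≤ F x ω) (hFW : ∀ x ω, ENNReal.ofReal (F x ω) ≤ W x ω) {s t : ℝ≥0}
    (hst : s ≤ t) :
    Integrable (fun η => F (walk t η.2) η.1) (P ⊗ₘ κ) ∧
    Integrable (fun q : ℝ × (Env d × PathSpace d) =>
      walkGenerator q.2.1 (fun y => F y q.2.1) (walk q.1.toNNReal q.2.2))
      (((volume : Measure ℝ).restrict (Ioc (s : ℝ) t)).prod (P ⊗ₘ κ)) ∧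
    ∀ G, MeasurableSet[annealedFiltration d s] G →
      ∫ η in G, F (walk t η.2) η.1 ∂(P ⊗ₘ κ) = ∫ η in G, F (walk s η.2) η.1 ∂(P ⊗ₘ κ)
        + ∫ q, walkGenerator q.2.1 (fun y => F y q.2.1) (walk q.1.toNNReal q.2.2)
          ∂(((volume : Measure ℝ).restrict (Ioc (s : ℝ) t)).prod ((P ⊗ₘ κ).restrict G)) := by
  set Q := P ⊗ₘ κ with hQ
  have hRQ : ∀ᵐ η ∂Q, RateBound Λ η.1 := ae_fst_of_ae hR
  set SF : Zd d → Env d → ℝ := fun x ω => walkGenerator ω (fun y => F y ω) x + Λ * F x ω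
  have hSF : ∀ x, Measurable (SF x) :=
    fun x => (measurable_walkGenerator hF x).add ((hF x).const_mul Λ)
  obtain ⟨C, hC⟩ := hW t
  have hFb : ∀ r ≤ t, ∫⁻ η, ‖F (walk r η.2) η.1‖ₑ ∂Q ≤ C := fun r hr =>
    (lintegral_mono fun η => by
      rw [Real.enorm_eq_ofReal (hF0 _ _)]
      exact (hFW _ _).trans le_self_add).trans (hC r hr)
  have hSFb : ∀ r ≤ t, ∫⁻ η, ‖SF (walk r η.2) η.1‖ₑ ∂Q ≤ C := fun r hr => by
    refine (lintegral_mono_ae ?_).trans (hC r hr)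
    filter_upwards [hRQ] with η hη
    rw [Real.enorm_eq_ofReal (walkGenerator_add_nonneg hη (fun x => hF0 x η.1) _),
      ← jumpOp_ofReal hη (fun x => hF0 x η.1)]
    exact (jumpOp_mono (fun x => hFW x η.1) _).trans le_add_self
  have hFi : ∀ r ≤ t, Integrable (fun η => F (walk r η.2) η.1) Q := fun r hr =>
    ⟨(measurable_comp_walk_ambient hF r).aestronglyMeasurable,
      (hFb r hr).trans_lt ENNReal.coe_lt_top⟩
  have hF2 := integrable_prod_of_lintegral_le (H := fun r η => F (walk r η.2) η.1) (Q := Q)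
    (s := s) (measurable_comp_walk_toNNReal hF) hFb
  have hSF2 := integrable_prod_of_lintegral_le (H := fun r η => SF (walk r η.2) η.1) (Q := Q)
    (s := s) (measurable_comp_walk_toNNReal hSF) hSFb
  have hL2 : Integrable (fun q : ℝ × (Env d × PathSpace d) =>
      walkGenerator q.2.1 (fun y => F y q.2.1) (walk q.1.toNNReal q.2.2))
      (((volume : Measure ℝ).restrict (Ioc (s : ℝ) t)).prod Q) :=
    (hSF2.sub (hF2.const_mul Λ)).congr (Eventually.of_forall fun q => by simp [SF])
  refine ⟨hFi t le_rfl, hL2, fun G hG => ?_⟩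
  have hle : ((volume : Measure ℝ).restrict (Ioc (s : ℝ) t)).prod (Q.restrict G)
      ≤ ((volume : Measure ℝ).restrict (Ioc (s : ℝ) t)).prod Q :=
    Measure.prod_mono le_rfl Measure.restrict_le_self
  have hd := annealed_dynkin hκ hΛ hR hst hG (F := fun x ω => ENNReal.ofReal (F x ω))
    fun x => (hF x).ennreal_ofReal
  rw [← hQ] at hd
  have h1 : ∀ r ≤ t, ∫⁻ η in G, ENNReal.ofReal (F (walk r η.2) η.1) ∂Q
      = ENNReal.ofReal (∫ η in G, F (walk r η.2) η.1 ∂Q) := fun r hr =>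
    (ofReal_integral_eq_lintegral_ofReal (hFi r hr).integrableOn
      (Eventually.of_forall fun η => hF0 _ _)).symm
  have h2 : ∫⁻ r in Ioc (s : ℝ) t, (∫⁻ η in G, ENNReal.ofReal (F (walk r.toNNReal η.2) η.1) ∂Q)
      = ENNReal.ofReal (∫ q, F (walk q.1.toNNReal q.2.2) q.2.1
        ∂(((volume : Measure ℝ).restrict (Ioc (s : ℝ) t)).prod (Q.restrict G))) := by
    rw [ofReal_integral_eq_lintegral_ofReal (hF2.mono_measure hle)
      (Eventually.of_forall fun η => hF0 _ _), lintegral_prod]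
    exact (measurable_comp_walk_toNNReal hF).ennreal_ofReal.aemeasurable
  have hSF0 : ∀ᵐ q ∂(((volume : Measure ℝ).restrict (Ioc (s : ℝ) t)).prod (Q.restrict G)),
      0 ≤ SF (walk q.1.toNNReal q.2.2) q.2.1 := by
    have := Measure.quasiMeasurePreserving_snd (μ := (volume : Measure ℝ).restrict
      (Ioc (s : ℝ) t)) (ν := Q.restrict G) |>.ae (ae_restrict_of_ae hRQ)
    filter_upwards [this] with q hq
    exact walkGenerator_add_nonneg hq (fun x => hF0 x q.2.1) _
  have h3 : ∫⁻ r in Ioc (s : ℝ) t, (∫⁻ η in G,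
        jumpOp Λ η.1 (fun y => ENNReal.ofReal (F y η.1)) (walk r.toNNReal η.2) ∂Q)
      = ENNReal.ofReal (∫ q, SF (walk q.1.toNNReal q.2.2) q.2.1
        ∂(((volume : Measure ℝ).restrict (Ioc (s : ℝ) t)).prod (Q.restrict G))) := by
    rw [ofReal_integral_eq_lintegral_ofReal (hSF2.mono_measure hle) hSF0, lintegral_prod]
    · refine lintegral_congr fun r => lintegral_congr_ae ?_
      filter_upwards [ae_restrict_of_ae hRQ] with η hη
      exact jumpOp_ofReal hη (fun x => hF0 x η.1) _
    · exact (measurable_comp_walk_toNNReal hSF).ennreal_ofReal.aemeasurable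
  rw [h1 t le_rfl, h1 s hst, h2, h3, ← ENNReal.ofReal_mul hΛ,
    ← ENNReal.ofReal_add (integral_nonneg fun η => hF0 _ _)
      (mul_nonneg hΛ (integral_nonneg fun η => hF0 _ _)),
    ← ENNReal.ofReal_add (integral_nonneg fun η => hF0 _ _) (integral_nonneg_of_ae hSF0),
    ENNReal.ofReal_eq_ofReal_iff (add_nonneg (integral_nonneg fun η => hF0 _ _)
      (mul_nonneg hΛ (integral_nonneg fun η => hF0 _ _)))
      (add_nonneg (integral_nonneg fun η => hF0 _ _) (integral_nonneg_of_ae hSF0))] at hd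
  have h4 : ∫ q, SF (walk q.1.toNNReal q.2.2) q.2.1
        ∂(((volume : Measure ℝ).restrict (Ioc (s : ℝ) t)).prod (Q.restrict G))
      = (∫ q, walkGenerator q.2.1 (fun y => F y q.2.1) (walk q.1.toNNReal q.2.2)
          ∂(((volume : Measure ℝ).restrict (Ioc (s : ℝ) t)).prod (Q.restrict G)))
        + Λ * ∫ q, F (walk q.1.toNNReal q.2.2) q.2.1
          ∂(((volume : Measure ℝ).restrict (Ioc (s : ℝ) t)).prod (Q.restrict G)) := by
    rw [← integral_const_mul, ← integral_add (hL2.mono_measure hle)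
      ((hF2.mono_measure hle).const_mul Λ)]
  rw [h4] at hd
  linarith

/-- The positive and negative parts of `F` are both dominated by the same `W`; linearity of the
generator recombines them. -/
theorem setIntegral_dynkinPart [IsProbabilityMeasure P]
    (hκ : ∀ᵐ ω ∂P, IsWalkLaw ω 0 (κ ω))
    (hΛ : 0 ≤ Λ) (hR : ∀ᵐ ω ∂P, RateBound Λ ω) {W : Zd d → Env d → ℝ≥0∞}
    (hW : MomentBound P κ Λ W) {F : Zd d → Env d → ℝ} (hF : ∀ x, Measurable (F x))
    (hFW : ∀ x ω, ENNReal.ofReal |F x ω| ≤ W x ω) :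
    (∀ t, Integrable (dynkinPart F t) (P ⊗ₘ κ)) ∧
    ∀ s t, s ≤ t → ∀ G, MeasurableSet[annealedFiltration d s] G →
      ∫ η in G, dynkinPart F t η ∂(P ⊗ₘ κ) = ∫ η in G, dynkinPart F s η ∂(P ⊗ₘ κ) := by
  set Fp : Zd d → Env d → ℝ := fun x ω => max (F x ω) 0
  set Fm : Zd d → Env d → ℝ := fun x ω => max (-F x ω) 0
  have hsub : ∀ x ω, F x ω = Fp x ω - Fm x ω := fun x ω =>
    (max_zero_sub_max_neg_zero_eq_self _).symm
  have hgen : ∀ x ω, walkGenerator ω (fun y => F y ω) x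
      = walkGenerator ω (fun y => Fp y ω) x - walkGenerator ω (fun y => Fm y ω) x := fun x ω => by
    simp only [walkGenerator, ← Finset.sum_sub_distrib]
    exact Finset.sum_congr rfl fun z _ => by rw [hsub, hsub x]; ring
  have hp : ∀ {s t : ℝ≥0}, s ≤ t → _ := fun {s t} hst =>
    dynkin_of_nonneg hκ hΛ hR hW (F := Fp) (s := s) (t := t)
    (fun x => (hF x).max measurable_const) (fun _ _ => le_max_right _ _)
    (fun x ω => (ENNReal.ofReal_le_ofReal (max_le (le_abs_self _) (abs_nonneg _))).trans
      (hFW x ω)) hst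
  have hm : ∀ {s t : ℝ≥0}, s ≤ t → _ := fun {s t} hst =>
    dynkin_of_nonneg hκ hΛ hR hW (F := Fm) (s := s) (t := t)
    (fun x => (hF x).neg.max measurable_const) (fun _ _ => le_max_right _ _)
    (fun x ω => (ENNReal.ofReal_le_ofReal (max_le (neg_le_abs _) (abs_nonneg _))).trans
      (hFW x ω)) hst
  have hFi : ∀ t : ℝ≥0, Integrable (fun η => F (walk t η.2) η.1) (P ⊗ₘ κ) := fun t =>
    ((hp (le_refl t)).1.sub (hm (le_refl t)).1).congr
      (Eventually.of_forall fun η => (hsub _ _).symm)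
  have hL2 : ∀ s t : ℝ≥0, s ≤ t → Integrable (fun q : ℝ × (Env d × PathSpace d) =>
      walkGenerator q.2.1 (fun y => F y q.2.1) (walk q.1.toNNReal q.2.2))
      (((volume : Measure ℝ).restrict (Ioc (s : ℝ) t)).prod (P ⊗ₘ κ)) := fun s t hst =>
    ((hp hst).2.1.sub (hm hst).2.1).congr (Eventually.of_forall fun η => (hgen _ _).symm)
  have hIi : ∀ s t : ℝ≥0, s ≤ t → Integrable (fun η : Env d × PathSpace d =>
      ∫ r in (s : ℝ)..t, walkGenerator η.1 (fun y => F y η.1) (walk r.toNNReal η.2))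
      (P ⊗ₘ κ) := fun s t hst => by
    have := (hL2 s t hst).integral_prod_right
    simpa only [intervalIntegral.integral_of_le (NNReal.coe_le_coe.2 hst)] using this
  have hIi0 : ∀ t : ℝ≥0, Integrable (fun η : Env d × PathSpace d =>
      ∫ r in (0 : ℝ)..t, walkGenerator η.1 (fun y => F y η.1) (walk r.toNNReal η.2))
      (P ⊗ₘ κ) := fun t => by simpa using hIi 0 t zero_le
  refine ⟨fun t => (hFi t).sub (hIi0 t), fun s t hst G hG => ?_⟩
  have hle : ((volume : Measure ℝ).restrict (Ioc (s : ℝ) t)).prod ((P ⊗ₘ κ).restrict G)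
      ≤ ((volume : Measure ℝ).restrict (Ioc (s : ℝ) t)).prod (P ⊗ₘ κ) :=
    Measure.prod_mono le_rfl Measure.restrict_le_self
  have h1 : ∫ η in G, F (walk t η.2) η.1 ∂(P ⊗ₘ κ) = ∫ η in G, F (walk s η.2) η.1 ∂(P ⊗ₘ κ)
      + ∫ η in G, (∫ r in (s : ℝ)..t,
        walkGenerator η.1 (fun y => F y η.1) (walk r.toNNReal η.2)) ∂(P ⊗ₘ κ) := by
    simp only [intervalIntegral.integral_of_le (NNReal.coe_le_coe.2 hst)]
    rw [← integral_prod_symm _ ((hL2 s t hst).mono_measure hle)]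
    simp only [hgen]
    simp only [hsub]
    rw [integral_sub (hp (le_refl t)).1.integrableOn (hm (le_refl t)).1.integrableOn,
      integral_sub (hp (le_refl s)).1.integrableOn (hm (le_refl s)).1.integrableOn,
      integral_sub ((hp hst).2.1.mono_measure hle) ((hm hst).2.1.mono_measure hle),
      (hp hst).2.2 G hG, (hm hst).2.2 G hG]
    ring
  have h2 : ∀ η : Env d × PathSpace d,
      (∫ r in (0 : ℝ)..t, walkGenerator η.1 (fun y => F y η.1) (walk r.toNNReal η.2))
      = (∫ r in (0 : ℝ)..s, walkGenerator η.1 (fun y => F y η.1) (walk r.toNNReal η.2))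
        + ∫ r in (s : ℝ)..t, walkGenerator η.1 (fun y => F y η.1) (walk r.toNNReal η.2) :=
    fun η => (intervalIntegral.integral_add_adjacent_intervals
      (intervalIntegrable_comp_walk _ _ _ _) (intervalIntegrable_comp_walk _ _ _ _)).symm
  unfold dynkinPart
  simp only [h2]
  have h3 : Integrable (fun η : Env d × PathSpace d =>
      (∫ r in (0 : ℝ)..s, walkGenerator η.1 (fun y => F y η.1) (walk r.toNNReal η.2))
        + ∫ r in (s : ℝ)..t, walkGenerator η.1 (fun y => F y η.1) (walk r.toNNReal η.2))
      (P ⊗ₘ κ) := (hIi0 s).add (hIi s t hst)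
  rw [integral_sub (hFi t).integrableOn h3.integrableOn,
    integral_add (hIi0 s).integrableOn (hIi s t hst).integrableOn,
    integral_sub (hFi s).integrableOn (hIi0 s).integrableOn, h1]
  ring

/-! ### Moment bounds -/

/-- By stationarity both expectations are constant in time, equal to `∫ h` and `Λ ∫ h`. -/
theorem momentBound_env (hP : IsEnvLaw P) (hκ : ∀ᵐ ω ∂P, IsWalkLaw ω 0 (κ ω)) (hΛ : 0 ≤ Λ)
    (hR : ∀ᵐ ω ∂P, RateBound Λ ω) {h : Env d → ℝ≥0∞} (hh : Measurable h)
    (hfin : ∫⁻ ω, h ω ∂P ≠ ∞) : MomentBound P κ Λ fun x ω => h (shift x ω) := by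
  have hm : Measurable fun ω => jumpOp Λ ω (fun y => h (shift y ω)) 0 :=
    measurable_jumpOp (fun y => hh.comp (measurable_shift y)) 0
  refine fun T => ⟨(∫⁻ ω, h ω ∂P + ENNReal.ofReal Λ * ∫⁻ ω, h ω ∂P).toNNReal, fun t _ => ?_⟩
  rw [ENNReal.coe_toNNReal (ENNReal.add_ne_top.2
    ⟨hfin, ENNReal.mul_ne_top ENNReal.ofReal_ne_top hfin⟩)]
  rw [lintegral_add_left (measurable_comp_walk_ambient (F := fun x ω => h (shift x ω))
    (fun x => hh.comp (measurable_shift x)) t)]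
  rw [← lintegral_jumpOp_comp_shift hP hR hh]
  rw [← annealed_lintegral_environment hP hκ hΛ hR t hh,
    ← annealed_lintegral_environment hP hκ hΛ hR t hm]
  refine add_le_add le_rfl (lintegral_mono fun η => ?_)
  rw [jumpOp_comp_shift]
  exact le_rfl

theorem momentBound_initial [SFinite P] (hR : ∀ᵐ ω ∂P, RateBound Λ ω) {h : Env d → ℝ≥0∞}
    (hh : Measurable h) (hfin : ∫⁻ ω, h ω ∂P ≠ ∞) : MomentBound P κ Λ fun _ ω => h ω := by
  refine fun T => ⟨((1 + ENNReal.ofReal Λ) * ∫⁻ ω, h ω ∂P).toNNReal, fun t _ => ?_⟩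
  rw [ENNReal.coe_toNNReal (ENNReal.mul_ne_top (by simp) hfin), ← lintegral_const_mul _ hh]
  have h1 : ∫⁻ ω, (1 + ENNReal.ofReal Λ) * h ω ∂P
      = ∫⁻ η, (1 + ENNReal.ofReal Λ) * h η.1 ∂(P ⊗ₘ κ) := by
    rw [Measure.lintegral_compProd (by fun_prop)]
    simp
  rw [h1]
  refine lintegral_mono_ae ?_
  filter_upwards [ae_fst_of_ae (κ := κ) hR] with η hη
  rw [jumpOp_const hη, add_mul, one_mul]

theorem dot_add (ξ : Fin d → ℝ) (x y : Zd d) : dot ξ (x + y) = dot ξ x + dot ξ y := by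
  simp [dot, mul_add, Finset.sum_add_distrib]

theorem dot_zero (ξ : Fin d → ℝ) : dot ξ 0 = 0 := by simp [dot]

theorem momentBound_dot [IsProbabilityMeasure P] (hκ : ∀ᵐ ω ∂P, IsWalkLaw ω 0 (κ ω)) (hΛ : 0 ≤ Λ)
    (hR : ∀ᵐ ω ∂P, RateBound Λ ω) (ξ : Fin d → ℝ) :
    MomentBound P κ Λ fun x _ => ENNReal.ofReal (1 + dot ξ x ^ 2) := by
  -- The largest factor by which `1 + (ξ·x)²` can grow in one jump: `1 + (a + c)² ≤ 2 (1 + c²)(1 +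
  -- a²)`, with `c²` bounded by the sum over all unit vectors. Hence `jumpOp` multiplies the weight
  -- by at most `Λ K`.
  set K : ℝ := 2 * (1 + ∑ z ∈ unitVectors d, dot ξ z ^ 2) with hK
  have hK1 : 1 ≤ K := by
    have : 0 ≤ ∑ z ∈ unitVectors d, dot ξ z ^ 2 := Finset.sum_nonneg fun _ _ => sq_nonneg _
    rw [hK]; linarith
  set w : Zd d → ℝ≥0∞ := fun x => ENNReal.ofReal (1 + dot ξ x ^ 2) with hw
  have hwz : ∀ x, ∀ z ∈ unitVectors d, w (x + z) ≤ ENNReal.ofReal K * w x := by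
    intro x z hz
    rw [hw, ← ENNReal.ofReal_mul (by linarith)]
    refine ENNReal.ofReal_le_ofReal ?_
    rw [dot_add]
    have h1 : dot ξ z ^ 2 ≤ ∑ z ∈ unitVectors d, dot ξ z ^ 2 :=
      Finset.single_le_sum (f := fun z => dot ξ z ^ 2) (fun _ _ => sq_nonneg _) hz
    have h2 : 2 * (1 + dot ξ z ^ 2) * (1 + dot ξ x ^ 2) ≤ K * (1 + dot ξ x ^ 2) := by
      rw [hK]; gcongr
    nlinarith [sq_nonneg (dot ξ x - dot ξ z), mul_nonneg (sq_nonneg (dot ξ z))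
      (sq_nonneg (dot ξ x))]
  have hS : ∀ ω, RateBound Λ ω → ∀ x, jumpOp Λ ω w x ≤ ENNReal.ofReal (Λ * K) * w x := by
    intro ω hω x
    rw [ENNReal.ofReal_mul hΛ, mul_assoc, ← congrFun (jumpOp_const hω (ENNReal.ofReal K * w x)) x]
    unfold jumpOp
    refine add_le_add (Finset.sum_le_sum fun z hz => ?_) ?_
    · gcongr
      exact hwz x z hz
    · gcongr
      exact le_mul_of_one_le_left zero_le (by simpa using hK1)
  refine fun T => ⟨((1 + ENNReal.ofReal (Λ * K)) *
    ENNReal.ofReal (Real.exp ((Λ * K - Λ) * T))).toNNReal, fun t ht => ?_⟩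
  rw [ENNReal.coe_toNNReal (ENNReal.mul_ne_top (by simp) ENNReal.ofReal_ne_top)]
  calc ∫⁻ η, (w (walk t η.2) + jumpOp Λ η.1 w (walk t η.2)) ∂(P ⊗ₘ κ)
      ≤ ∫⁻ η, (1 + ENNReal.ofReal (Λ * K)) * w (walk t η.2) ∂(P ⊗ₘ κ) := by
        refine lintegral_mono_ae ?_
        filter_upwards [ae_fst_of_ae (κ := κ) hR] with η hη
        rw [add_mul, one_mul]
        gcongr
        exact hS _ hη _
    _ = (1 + ENNReal.ofReal (Λ * K)) * ∫⁻ ω, walkSemigroup Λ ω t w 0 ∂P := by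
        rw [lintegral_const_mul' _ _ (by simp),
          annealed_lintegral_walk hκ hΛ hR t (F := fun x _ => w x) fun x => measurable_const]
    _ ≤ (1 + ENNReal.ofReal (Λ * K)) *
        ∫⁻ ω, ENNReal.ofReal (Real.exp ((Λ * K - Λ) * T)) ∂P := by
        refine mul_le_mul_right ?_ _
        refine lintegral_mono_ae ?_
        filter_upwards [hR] with ω hω
        refine (walkSemigroup_le (mul_nonneg hΛ (by linarith)) t.coe_nonneg (hS ω hω) 0).trans ?_
        have hw0 : w 0 = 1 := by simp [hw, dot_zero]
        rw [hw0, mul_one]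
        refine ENNReal.ofReal_le_ofReal (Real.exp_le_exp.2 ?_)
        have : 0 ≤ Λ * K - Λ := by nlinarith
        gcongr
    _ = _ := by simp

end

end RandomConductance

namespace RandomConductance

variable {d : ℕ}

/-! ### Path properties of the processes of the theorem -/

/-- The chain rule for the square of a primitive. The integrand jumps, but it is right-continuous,
and right derivatives of a continuous function suffice for the fundamental theorem of calculus. -/
theorem sq_integral_walk (g : Zd d → ℝ) (γ : PathSpace d) (t : ℝ) :
    (∫ r in (0 : ℝ)..t, g (walk r.toNNReal γ)) ^ 2
      = 2 * ∫ r in (0 : ℝ)..t, (∫ u in (0 : ℝ)..r, g (walk u.toNNReal γ)) 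
        * g (walk r.toNNReal γ) := by
  have hi := intervalIntegrable_comp_walk g γ
  have hc : Continuous fun r : ℝ => ∫ u in (0 : ℝ)..r, g (walk u.toNNReal γ) :=
    intervalIntegral.continuous_primitive hi 0
  have hm : Measurable fun r : ℝ => g (walk r.toNNReal γ) :=
    (measurable_of_countable g).comp (measurable_walk_toNNReal.comp measurable_prodMk_right)
  have hd : ∀ r, HasDerivWithinAt (fun r : ℝ => ∫ u in (0 : ℝ)..r, g (walk u.toNNReal γ))
      (g (walk r.toNNReal γ)) (Ioi r) r := by
    intro r
    refine (intervalIntegral.integral_hasDerivWithinAt_right (hi 0 r) (s := Ici r) (t := Ioi r)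
      hm.stronglyMeasurable.stronglyMeasurableAtFilter ?_).mono Ioi_subset_Ici_self
    have h1 : ∀ᶠ u in 𝓝[>] r, g (walk r.toNNReal γ) = g (walk u.toNNReal γ) :=
      ((eventually_walk_toNNReal_eq γ r).filter_mono
        (nhdsWithin_mono r Ioi_subset_Ici_self)).mono fun u hu => by rw [hu]
    exact tendsto_const_nhds.congr' h1
  have h := intervalIntegral.integral_eq_sub_of_hasDeriv_right
    (f := fun r : ℝ => (∫ u in (0 : ℝ)..r, g (walk u.toNNReal γ)) ^ 2) (a := 0) (b := t)
    (f' := fun r => 2 * ((∫ u in (0 : ℝ)..r, g (walk u.toNNReal γ)) * g (walk r.toNNReal γ)))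
    (hc.pow 2).continuousOn
    (fun r _ => ((hd r).fun_pow 2).congr_deriv (by simp; ring))
    (((hi 0 t).continuousOn_mul hc.continuousOn).const_mul 2)
  rw [intervalIntegral.integral_const_mul] at h
  simpa using h.symm

theorem measurable_of_isStronglyPredictable {S : Type*} {mS : MeasurableSpace S}
    {ℱ : Filtration ℝ≥0 mS} {A : ℝ≥0 → S → ℝ} (hA : IsStronglyPredictable ℱ A) :
    Measurable fun q : ℝ≥0 × S => A q.1 q.2 := by
  have hle : ℱ.predictable ≤ (inferInstance : MeasurableSpace (ℝ≥0 × S)) :=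
    measurableSpace_le_predictable_of_measurableSet
      (fun B hB => (measurableSet_singleton _).prod (ℱ.le _ _ hB))
      (fun i B hB => measurableSet_Ioi.prod (ℱ.le _ _ hB))
  exact (hA.mono hle).measurable

theorem isStronglyPredictable_integral_walk {F : Zd d → Env d → ℝ} (hF : ∀ x, Measurable (F x)) :
    IsStronglyPredictable (annealedFiltration d) fun (t : ℝ≥0) η =>
      ∫ r in (0 : ℝ)..t, F (walk r.toNNReal η.2) η.1 :=
  isStronglyPredictable_of_continuous (measurable_integral_walk hF)
    fun η => continuous_integral_walk (fun x => F x η.1) η.2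

/-! ### The process `martingalePart` and the corrected coordinate -/

section MartingalePart

variable {ξ : Fin d → ℝ} {mu : ℝ} {φ : Env d → ℝ}

theorem measurable_martingalePart (hφ : Measurable φ) (t : ℝ≥0) :
    Measurable[annealedFiltration d t] (martingalePart ξ mu φ t) := by
  have hφx : ∀ x, Measurable fun ω => φ (shift x ω) := fun x => hφ.comp (measurable_shift x)
  have h1 := measurable_comp_walk (F := fun x _ => dot ξ x) (fun x => measurable_const) t
  have h2 := measurable_comp_walk (F := fun x ω => φ (shift x ω)) hφx t
  have h3 := (measurable_comp_walk (F := fun x ω => φ (shift x ω)) hφx 0).mono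
    ((annealedFiltration d).mono (zero_le (a := t))) le_rfl
  have h4 := measurable_integral_walk (F := fun x ω => φ (shift x ω)) hφx t
  exact ((h1.add h2).sub h3).sub (h4.const_mul mu)

theorem measurable_martingalePart_toNNReal (hφ : Measurable φ) :
    Measurable fun q : ℝ × (Env d × PathSpace d) => martingalePart ξ mu φ q.1.toNNReal q.2 := by
  have hφx : ∀ x, Measurable fun ω => φ (shift x ω) := fun x => hφ.comp (measurable_shift x)
  have h1 := measurable_comp_walk_toNNReal (F := fun (x : Zd d) _ => dot ξ x)
    (fun x => measurable_const)
  have h2 := measurable_comp_walk_toNNReal (F := fun x ω => φ (shift x ω)) hφx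
  have h3 : Measurable fun q : ℝ × (Env d × PathSpace d) => φ (shift (walk 0 q.2.2) q.2.1) :=
    (measurable_comp_walk_ambient (F := fun x ω => φ (shift x ω)) hφx 0).comp measurable_snd
  have h4 := (measurable_of_isStronglyPredictable (isStronglyPredictable_integral_walk
    (F := fun x ω => φ (shift x ω)) hφx)).comp
      (measurable_real_toNNReal.prodMap (measurable_id (α := Env d × PathSpace d)))
  exact ((h1.add h2).sub h3).sub (h4.const_mul mu)

theorem isCadlag_martingalePart (η : Env d × PathSpace d) :
    IsCadlag fun t => martingalePart ξ mu φ t η := by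
  have h1 : IsCadlag fun t => dot ξ (walk t η.2) + φ (shift (walk t η.2) η.1) :=
    η.2.2.comp_of_discrete fun x => dot ξ x + φ (shift x η.1)
  have h2 : Continuous fun t : ℝ≥0 => -φ (envProcess 0 η)
      - mu * ∫ s in (0 : ℝ)..t, φ (envProcess s.toNNReal η) :=
    continuous_const.sub (continuous_const.mul
      (continuous_integral_walk (fun x => φ (shift x η.1)) η.2))
  convert h1.add (isCadlag_of_continuous h2) using 2 with t
  simp only [martingalePart, envProcess]
  ring

/-- Along a path `M_μ` is a function of the current site plus a continuous term, and each piece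
times `g` is integrable. -/
theorem intervalIntegrable_martingalePart_mul (g : Zd d → ℝ) (η : Env d × PathSpace d)
    (a b : ℝ) :
    IntervalIntegrable (fun r : ℝ => martingalePart ξ mu φ r.toNNReal η * g (walk r.toNNReal η.2))
      volume a b := by
  have h2 : Continuous fun r : ℝ => -φ (envProcess 0 η)
      - mu * ∫ s in (0 : ℝ)..(r.toNNReal : ℝ≥0), φ (envProcess s.toNNReal η) :=
    continuous_const.sub (continuous_const.mul
      ((continuous_integral_walk (fun x => φ (shift x η.1)) η.2).comp continuous_real_toNNReal))
  have h3 := (intervalIntegrable_comp_walk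
    (fun x => (dot ξ x + φ (shift x η.1)) * g x) η.2 a b).add
    ((intervalIntegrable_comp_walk g η.2 a b).continuousOn_mul h2.continuousOn)
  refine h3.congr fun r _ => ?_
  simp only [martingalePart, envProcess]
  ring

/-- The corrected coordinate `ξ · x + φ(θ_x ω) - φ(ω)`. -/
noncomputable def correctedCoord (ξ : Fin d → ℝ) (φ : Env d → ℝ) (x : Zd d) (ω : Env d) : ℝ :=
  dot ξ x + φ (shift x ω) - φ ω

theorem measurable_correctedCoord (hφ : Measurable φ) (x : Zd d) :
    Measurable (correctedCoord ξ φ x) :=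
  ((hφ.comp (measurable_shift x)).const_add _).sub hφ

theorem correctedCoord_add_sub (x z : Zd d) (ω : Env d) :
    correctedCoord ξ φ (x + z) ω - correctedCoord ξ φ x ω
      = dot ξ z + φ (shift z (shift x ω)) - φ (shift x ω) := by
  simp only [correctedCoord, dot_add, shift_add]
  ring

/-- The term `φ(ω)` does not depend on the site and drops out of the increments. The right side is
what the resolvent equation evaluates to `μ φ(θ_x ω)`. -/
theorem walkGenerator_correctedCoord (ω : Env d) (x : Zd d) :
    walkGenerator ω (fun y => correctedCoord ξ φ y ω) x
      = localDrift ξ (shift x ω) + envGenerator φ (shift x ω) := by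
  simp only [localDrift, envGenerator, walkGenerator, correctedCoord_add_sub,
    ← Finset.sum_add_distrib, conductance_shift, zero_add, add_zero, dot_zero]
  exact Finset.sum_congr rfl fun z _ => by ring

/-- The carré du champ identity, jump by jump: `(a' - a)² = (a'² - a²) - 2a(a' - a)`. -/
theorem energyDensity_shift (ω : Env d) (x : Zd d) :
    energyDensity ξ φ (shift x ω)
      = walkGenerator ω (fun y => correctedCoord ξ φ y ω ^ 2) x
        - 2 * correctedCoord ξ φ x ω * walkGenerator ω (fun y => correctedCoord ξ φ y ω) x := by
  simp only [energyDensity, walkGenerator, Finset.mul_sum, ← Finset.sum_sub_distrib,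
    conductance_shift, add_zero]
  refine Finset.sum_congr rfl fun z _ => ?_
  rw [← correctedCoord_add_sub]
  ring

theorem measurable_energyDensity_shift (hφ : Measurable φ) (x : Zd d) :
    Measurable fun ω => energyDensity ξ φ (shift x ω) := by
  simp only [energyDensity_shift]
  exact (measurable_walkGenerator (fun y => (measurable_correctedCoord hφ y).pow_const 2) x).sub
    (((measurable_correctedCoord hφ x).const_mul 2).mul
      (measurable_walkGenerator (fun y => measurable_correctedCoord hφ y) x))

theorem energyDensity_nonneg (ω : Env d) : 0 ≤ energyDensity ξ φ ω :=
  Finset.sum_nonneg fun _ _ => mul_nonneg (conductance_nonneg _ _ _) (sq_nonneg _)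

theorem martingalePart_eq {η : Env d × PathSpace d} (h0 : walk 0 η.2 = 0) (t : ℝ≥0) :
    martingalePart ξ mu φ t η = correctedCoord ξ φ (walk t η.2) η.1
      - ∫ r in (0 : ℝ)..t, mu * φ (envProcess r.toNNReal η) := by
  rw [intervalIntegral.integral_const_mul]
  simp only [martingalePart, correctedCoord, envProcess, h0, shift_zero]

/-- Pathwise algebra with `F = M + B`: the compensator is `∫ L F² - 2 ∫ F b = ∫ L F² - 2 ∫ M b -
B²`, so the `B²` produced by expanding `M² = F² - 2 M B - B²` cancels. -/
theorem martingalePart_sq_sub {η : Env d × PathSpace d} (h0 : walk 0 η.2 = 0)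
    (hL : ∀ x, walkGenerator η.1 (fun y => correctedCoord ξ φ y η.1) x = mu * φ (shift x η.1))
    (t : ℝ≥0) :
    martingalePart ξ mu φ t η ^ 2 - ∫ s in (0 : ℝ)..t, energyDensity ξ φ (envProcess s.toNNReal η)
      = dynkinPart (fun x ω => correctedCoord ξ φ x ω ^ 2) t η
        - 2 * (martingalePart ξ mu φ t η * (∫ r in (0 : ℝ)..t, mu * φ (envProcess r.toNNReal η))
          - ∫ r in (0 : ℝ)..t,
            martingalePart ξ mu φ r.toNNReal η * (mu * φ (envProcess r.toNNReal η))) := by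
  set B : ℝ → ℝ := fun t => ∫ r in (0 : ℝ)..t, mu * φ (envProcess r.toNNReal η) with hB
  have hsq : B t ^ 2 = 2 * ∫ r in (0 : ℝ)..t, B r * (mu * φ (envProcess r.toNNReal η)) :=
    sq_integral_walk (fun x => mu * φ (shift x η.1)) η.2 t
  have hBc : Continuous B := intervalIntegral.continuous_primitive
    (intervalIntegrable_comp_walk (fun x => mu * φ (shift x η.1)) η.2) 0
  have hi1 : IntervalIntegrable (fun r : ℝ => walkGenerator η.1
      (fun y => correctedCoord ξ φ y η.1 ^ 2) (walk r.toNNReal η.2)) volume 0 t :=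
    intervalIntegrable_comp_walk _ _ _ _
  have hi2 : IntervalIntegrable (fun r : ℝ =>
      martingalePart ξ mu φ r.toNNReal η * (mu * φ (envProcess r.toNNReal η))) volume 0 t :=
    intervalIntegrable_martingalePart_mul (fun x => mu * φ (shift x η.1)) η 0 t
  have hi3 : IntervalIntegrable (fun r : ℝ => B r * (mu * φ (envProcess r.toNNReal η)))
      volume 0 t :=
    (intervalIntegrable_comp_walk (fun x => mu * φ (shift x η.1)) η.2 0 t).continuousOn_mul
      hBc.continuousOn
  have hA : ∫ s in (0 : ℝ)..t, energyDensity ξ φ (envProcess s.toNNReal η)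
      = (∫ r in (0 : ℝ)..t, walkGenerator η.1
          (fun y => correctedCoord ξ φ y η.1 ^ 2) (walk r.toNNReal η.2))
        - 2 * (∫ r in (0 : ℝ)..t,
            martingalePart ξ mu φ r.toNNReal η * (mu * φ (envProcess r.toNNReal η)))
        - 2 * ∫ r in (0 : ℝ)..t, B r * (mu * φ (envProcess r.toNNReal η)) := by
    rw [← intervalIntegral.integral_const_mul, ← intervalIntegral.integral_const_mul,
      ← intervalIntegral.integral_sub hi1 (hi2.const_mul 2),
      ← intervalIntegral.integral_sub (hi1.sub (hi2.const_mul 2)) (hi3.const_mul 2)]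
    refine intervalIntegral.integral_congr fun r hr => ?_
    rw [uIcc_of_le t.coe_nonneg] at hr
    rw [envProcess, energyDensity_shift, hL, martingalePart_eq h0, Real.coe_toNNReal r hr.1]
    simp only [hB, envProcess]
    ring
  have hM := martingalePart_eq (ξ := ξ) (mu := mu) (φ := φ) h0 t
  have hMB : correctedCoord ξ φ (walk t η.2) η.1 = martingalePart ξ mu φ t η + B t := by
    rw [hM]; simp [hB]
  rw [hA, ← hsq, dynkinPart, hMB]
  change _ = _ - 2 * (_ * B t - _)
  ring

end MartingalePart

/-! ### Consequences of the standing assumptions -/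

theorem IsEnvLaw.exists_rateBound {P : Measure (Env d)} (hP : IsEnvLaw P) :
    ∃ Λ : ℝ, 0 ≤ Λ ∧ ∀ᵐ ω ∂P, RateBound Λ ω := by
  obtain ⟨M, hM, h⟩ := hP.elliptic
  refine ⟨(unitVectors d).card * M, by positivity, ?_⟩
  filter_upwards [h] with ω hω x
  rw [← nsmul_eq_mul]
  refine Finset.sum_le_card_nsmul _ _ _ fun z _ => ?_
  unfold conductance
  split_ifs with hz
  · exact (hω _).2
  · exact hM.le

/-- The resolvent equation holds only almost surely; shift invariance transports it to each `θ_x ω`,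
and countability of the lattice yields one null set for all sites. -/
theorem IsApproxCorrector.ae_walkGenerator {P : Measure (Env d)} (hP : IsEnvLaw P)
    {ξ : Fin d → ℝ} {mu : ℝ} {φ : Env d → ℝ} (hφ : IsApproxCorrector P ξ mu φ) :
    ∀ᵐ ω ∂P, ∀ x,
      walkGenerator ω (fun y => correctedCoord ξ φ y ω) x = mu * φ (shift x ω) := by
  refine ae_all_iff.2 fun x => ?_
  filter_upwards [(hP.measurePreserving_shift x).quasiMeasurePreserving.ae hφ.resolvent_eq]
    with ω hω
  rw [walkGenerator_correctedCoord, ← hω]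
  ring

theorem ae_walk_zero {P : Measure (Env d)} [SFinite P] {κ : Kernel (Env d) (PathSpace d)}
    [IsMarkovKernel κ] (hκ : ∀ᵐ ω ∂P, IsWalkLaw ω 0 (κ ω)) :
    ∀ᵐ η ∂(P ⊗ₘ κ), walk 0 η.2 = 0 := by
  refine (Measure.ae_compProd_iff ?_).2 (hκ.mono fun ω hω => hω.start)
  exact ((measurable_walk 0).comp measurable_snd) (measurableSet_singleton 0)

theorem IsApproxCorrector.lintegral_sq_ne_top {P : Measure (Env d)}
    {ξ : Fin d → ℝ} {mu : ℝ} {φ : Env d → ℝ} (hφ : IsApproxCorrector P ξ mu φ) :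
    ∫⁻ ω, ENNReal.ofReal (φ ω ^ 2) ∂P ≠ ∞ :=
  hφ.memLp.integrable_sq.lintegral_lt_top.ne

/-- A function dominating the corrected coordinate and its square. -/
noncomputable def dominatingFun (ξ : Fin d → ℝ) (φ : Env d → ℝ) (x : Zd d) (ω : Env d) : ℝ≥0∞ :=
  (3 : ℝ≥0) * (ENNReal.ofReal (1 + dot ξ x ^ 2) + ENNReal.ofReal (φ (shift x ω) ^ 2)
    + ENNReal.ofReal (φ ω ^ 2))

theorem dominatingFun_eq (ξ : Fin d → ℝ) (φ : Env d → ℝ) (x : Zd d) (ω : Env d) :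
    dominatingFun ξ φ x ω
      = ENNReal.ofReal (3 * (1 + dot ξ x ^ 2 + φ (shift x ω) ^ 2 + φ ω ^ 2)) := by
  rw [dominatingFun, ENNReal.ofReal_mul (by norm_num),
    ENNReal.ofReal_add (p := 1 + dot ξ x ^ 2 + φ (shift x ω) ^ 2) (by positivity) (by positivity),
    ENNReal.ofReal_add (p := 1 + dot ξ x ^ 2) (by positivity) (by positivity)]
  norm_num

/-- The summand `1` in `dominatingFun` is there for this first-power bound, via `2|a| ≤ 1 + a²`; the
factor `3` is the constant in `(a + b - c)² ≤ 3 (a² + b² + c²)` for the next lemma. -/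
theorem abs_correctedCoord_le (ξ : Fin d → ℝ) (φ : Env d → ℝ) (x : Zd d) (ω : Env d) :
    ENNReal.ofReal |correctedCoord ξ φ x ω| ≤ dominatingFun ξ φ x ω := by
  rw [dominatingFun_eq]
  refine ENNReal.ofReal_le_ofReal (abs_le.2 ⟨?_, ?_⟩) <;> unfold correctedCoord <;>
  nlinarith [sq_nonneg (dot ξ x - 1), sq_nonneg (dot ξ x + 1), sq_nonneg (φ (shift x ω) - 1),
    sq_nonneg (φ (shift x ω) + 1), sq_nonneg (φ ω - 1), sq_nonneg (φ ω + 1)]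

theorem sq_correctedCoord_le (ξ : Fin d → ℝ) (φ : Env d → ℝ) (x : Zd d) (ω : Env d) :
    ENNReal.ofReal (correctedCoord ξ φ x ω ^ 2) ≤ dominatingFun ξ φ x ω := by
  rw [dominatingFun_eq]
  refine ENNReal.ofReal_le_ofReal ?_
  unfold correctedCoord
  nlinarith [sq_nonneg (dot ξ x - φ (shift x ω)), sq_nonneg (dot ξ x + φ ω),
    sq_nonneg (φ (shift x ω) + φ ω)]

theorem momentBound_dominatingFun {P : Measure (Env d)} {κ : Kernel (Env d) (PathSpace d)}
    [IsMarkovKernel κ] {Λ : ℝ} (hP : IsEnvLaw P) (hκ : ∀ᵐ ω ∂P, IsWalkLaw ω 0 (κ ω)) (hΛ : 0 ≤ Λ)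
    (hR : ∀ᵐ ω ∂P, RateBound Λ ω) {ξ : Fin d → ℝ} {mu : ℝ} {φ : Env d → ℝ}
    (hφ : IsApproxCorrector P ξ mu φ) : MomentBound P κ Λ (dominatingFun ξ φ) := by
  have := hP.isProbabilityMeasure
  have hm : Measurable fun ω => ENNReal.ofReal (φ ω ^ 2) :=
    (hφ.measurable.pow_const 2).ennreal_ofReal
  exact (((momentBound_dot hκ hΛ hR ξ).add (fun x => measurable_const)
    (momentBound_env hP hκ hΛ hR hm hφ.lintegral_sq_ne_top)).add
    (fun x => (hm.comp (measurable_shift x)).const_add _)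
    (momentBound_initial hR hm hφ.lintegral_sq_ne_top)).const_mul 3

end RandomConductance

/-! ### Proof of the proposition -/

theorem mainTheorem5 (d : ℕ) (P : Measure (Env d)) (hP : IsEnvLaw P)
    (κ : Kernel (Env d) (PathSpace d)) [IsMarkovKernel κ]
    (hκ : ∀ᵐ ω ∂P, IsWalkLaw ω 0 (κ ω))
    (ξ : Fin d → ℝ) (mu : ℝ) (hmu : 0 < mu)
    (φ : Env d → ℝ) (hφ : IsApproxCorrector P ξ mu φ) :
    Martingale (martingalePart ξ mu φ) (annealedFiltration d) (P ⊗ₘ κ) ∧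
    IsPredictableQuadraticVariation (martingalePart ξ mu φ)
      (fun t η => ∫ s in (0 : ℝ)..t, energyDensity ξ φ (envProcess s.toNNReal η))
      (annealedFiltration d) (P ⊗ₘ κ) := by
  have := hP.isProbabilityMeasure
  obtain ⟨Λ, hΛ, hR⟩ := hP.exists_rateBound
  have hW := momentBound_dominatingFun hP hκ hΛ hR hφ
  have h0 := ae_walk_zero hκ
  have hL := ae_fst_of_ae (κ := κ) (hφ.ae_walkGenerator hP)
  have hF := measurable_correctedCoord (ξ := ξ) hφ.measurable
  have hadapt : StronglyAdapted (annealedFiltration d) (martingalePart ξ mu φ) :=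
    fun t => (measurable_martingalePart hφ.measurable t).stronglyMeasurable
  set b : ℝ≥0 → Env d × PathSpace d → ℝ := fun t η => mu * φ (envProcess t η) with hb
  have hbx : ∀ x, Measurable fun ω => mu * φ (shift x ω) :=
    fun x => (hφ.measurable.comp (measurable_shift x)).const_mul mu
  -- `M` is the Dynkin martingale of the corrected coordinate
  obtain ⟨hi1, hs1⟩ := setIntegral_dynkinPart hκ hΛ hR hW hF (abs_correctedCoord_le ξ φ)
  have hD1 : ∀ᵐ η ∂(P ⊗ₘ κ), ∀ t,
      dynkinPart (correctedCoord ξ φ) t η = martingalePart ξ mu φ t η := by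
    filter_upwards [h0, hL] with η h0 hL t
    simp only [dynkinPart, martingalePart_eq h0, hL, envProcess]
  have hmart : Martingale (martingalePart ξ mu φ) (annealedFiltration d) (P ⊗ₘ κ) := by
    refine martingale_of_setIntegral_eq hadapt
      (fun t => (hi1 t).congr (hD1.mono fun η h => h t)) fun s t hst G hG => ?_
    have h1 := hs1 s t hst G hG
    rwa [integral_congr_ae (ae_restrict_of_ae (hD1.mono fun η h => h t)),
      integral_congr_ae (ae_restrict_of_ae (hD1.mono fun η h => h s))] at h1
  -- second moments
  have hb2 : ∀ t, ∫⁻ η, ENNReal.ofReal (b t η ^ 2) ∂(P ⊗ₘ κ)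
      = ∫⁻ ω, ENNReal.ofReal ((mu * φ ω) ^ 2) ∂P := fun t =>
    annealed_lintegral_environment hP hκ hΛ hR t
      ((hφ.measurable.const_mul mu).pow_const 2).ennreal_ofReal
  have hb2' : ∀ T : ℝ≥0, ∃ C : ℝ≥0, ∀ t ≤ T,
      ∫⁻ η, ENNReal.ofReal (b t η ^ 2) ∂(P ⊗ₘ κ) ≤ C := fun T =>
    ⟨_, fun t _ => by
      rw [hb2, ENNReal.coe_toNNReal
        (hφ.memLp.const_mul mu).integrable_sq.lintegral_lt_top.ne]⟩
  have hbm : Measurable fun q : ℝ × (Env d × PathSpace d) => b q.1.toNNReal q.2 :=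
    measurable_comp_walk_toNNReal (F := fun x ω => mu * φ (shift x ω)) hbx
  have hbi : ∀ (η : Env d × PathSpace d) (a c : ℝ),
      IntervalIntegrable (fun r : ℝ => b r.toNNReal η) volume a c := fun η =>
    intervalIntegrable_comp_walk (fun x => mu * φ (shift x η.1)) η.2
  have hbi2 : ∀ (η : Env d × PathSpace d) (a c : ℝ),
      IntervalIntegrable (fun r : ℝ => b r.toNNReal η ^ 2) volume a c := fun η =>
    intervalIntegrable_comp_walk (fun x => (mu * φ (shift x η.1)) ^ 2) η.2
  have hM2 : ∀ T : ℝ≥0, ∃ C : ℝ≥0, ∀ t ≤ T,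
      ∫⁻ η, ENNReal.ofReal (martingalePart ξ mu φ t η ^ 2) ∂(P ⊗ₘ κ) ≤ C := by
    intro T
    obtain ⟨C, hC⟩ := hW T
    obtain ⟨D, hD⟩ := hb2' T
    -- From `(F - B)² ≤ 2 (F² + B²)`: `C` bounds the moment of `F²`, and `T² D` that of `B²` by
    -- Cauchy–Schwarz in time.
    refine ⟨2 * (C + T * T * D), fun t ht => ?_⟩
    have hm : Measurable fun η : Env d × PathSpace d =>
        ENNReal.ofReal (correctedCoord ξ φ (walk t η.2) η.1 ^ 2) :=
      ((measurable_comp_walk_ambient hF t).pow_const 2).ennreal_ofReal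
    calc ∫⁻ η, ENNReal.ofReal (martingalePart ξ mu φ t η ^ 2) ∂(P ⊗ₘ κ)
        ≤ ∫⁻ η, (2 : ℝ≥0) * (ENNReal.ofReal (correctedCoord ξ φ (walk t η.2) η.1 ^ 2)
          + ENNReal.ofReal ((∫ r in (0 : ℝ)..t, b r.toNNReal η) ^ 2)) ∂(P ⊗ₘ κ) := by
          refine lintegral_mono_ae ?_
          filter_upwards [h0] with η h0
          rw [martingalePart_eq h0, ← ENNReal.ofReal_add (sq_nonneg _) (sq_nonneg _),
            ← ENNReal.ofReal_coe_nnreal, ← ENNReal.ofReal_mul (by positivity)]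
          refine ENNReal.ofReal_le_ofReal ?_
          simp only [hb, NNReal.coe_ofNat]
          nlinarith [sq_nonneg (correctedCoord ξ φ (walk t η.2) η.1
            + ∫ r in (0 : ℝ)..t, mu * φ (envProcess r.toNNReal η))]
      _ ≤ (2 * (C + T * T * D) : ℝ≥0) := by
          rw [lintegral_const_mul' _ _ ENNReal.coe_ne_top, lintegral_add_left hm,
            ENNReal.coe_mul, ENNReal.coe_add]
          gcongr
          · exact (lintegral_mono fun η => (sq_correctedCoord_le ξ φ _ _).trans
              le_self_add).trans (hC t ht)
          · exact lintegral_sq_intervalIntegral_le hbm hbi hbi2 ht hD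
  -- the compensated square
  obtain ⟨hi2, hs2⟩ := setIntegral_dynkinPart hκ hΛ hR hW
    (F := fun x ω => correctedCoord ξ φ x ω ^ 2) (fun x => (hF x).pow_const 2)
    (fun x ω => by rw [abs_of_nonneg (sq_nonneg _)]; exact sq_correctedCoord_le ξ φ x ω)
  obtain ⟨hi3, hs3⟩ := setIntegral_mul_sub_integral hmart
    (measurable_martingalePart_toNNReal hφ.measurable) hbm
    (fun t => measurable_comp_walk (F := fun x ω => mu * φ (shift x ω)) hbx t)
    (fun t => measurable_integral_walk (F := fun x ω => mu * φ (shift x ω)) hbx t)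
    hM2 hb2' hbi hbi2
    (fun η => intervalIntegrable_martingalePart_mul (fun x => mu * φ (shift x η.1)) η)
  -- The path must start at `0` and the generator equation must hold at all sites; off this null set
  -- the decomposition holds for all times simultaneously.
  have hsq : ∀ᵐ η ∂(P ⊗ₘ κ), ∀ t : ℝ≥0, _ :=
    (h0.and hL).mono fun η h => martingalePart_sq_sub h.1 h.2
  have hAx := measurable_energyDensity_shift (ξ := ξ) hφ.measurable
  have hint : ∀ t : ℝ≥0, Integrable (fun η => martingalePart ξ mu φ t η ^ 2
      - ∫ s in (0 : ℝ)..t, energyDensity ξ φ (envProcess s.toNNReal η)) (P ⊗ₘ κ) := fun t =>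
    ((hi2 t).sub ((hi3 t).const_mul 2)).congr (hsq.mono fun η h => (h t).symm)
  refine ⟨hmart, ⟨hmart, fun t => ?_, Eventually.of_forall isCadlag_martingalePart,
    isStronglyPredictable_integral_walk (F := fun x ω => energyDensity ξ φ (shift x ω)) hAx,
    Eventually.of_forall fun η => by simp, Eventually.of_forall fun η s t hst => ?_,
    Eventually.of_forall fun η => isCadlag_of_continuous
      (continuous_integral_walk (fun x => energyDensity ξ φ (shift x η.1)) η.2), ?_⟩⟩
  · obtain ⟨C, hC⟩ := hM2 t
    exact memLp_two_of_lintegral_sq ((hadapt t).mono ((annealedFiltration d).le t)).measurable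
      (ne_top_of_le_ne_top ENNReal.coe_ne_top (hC t le_rfl))
  · have hi := intervalIntegrable_comp_walk (fun x => energyDensity ξ φ (shift x η.1)) η.2
    exact intervalIntegral.integral_mono_interval le_rfl s.coe_nonneg (NNReal.coe_le_coe.2 hst)
      (Eventually.of_forall fun r => energyDensity_nonneg _) (hi 0 t)
  · refine martingale_of_setIntegral_eq (fun t => ?_) hint fun s t hst G hG => ?_
    · exact (((measurable_martingalePart hφ.measurable t).pow_const 2).sub
        (measurable_integral_walk (F := fun x ω => energyDensity ξ φ (shift x ω))
          hAx t)).stronglyMeasurable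
    · rw [integral_congr_ae (ae_restrict_of_ae (hsq.mono fun η h => h t)),
        integral_congr_ae (ae_restrict_of_ae (hsq.mono fun η h => h s)),
        integral_sub (hi2 t).integrableOn ((hi3 t).const_mul 2).integrableOn,
        integral_sub (hi2 s).integrableOn ((hi3 s).const_mul 2).integrableOn,
        integral_const_mul, integral_const_mul, hs2 s t hst G hG, hs3 s t hst G hG]
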